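/- **Setting.** Let $\Bbbk$ be a field and $\Upsilon$ a finite set of generators, each generator $\mu$ having an arity $\mathrm{ar}(\mu)\ge 1$. A *shuffle monomial* of arity $n$ is a rooted tree whose internal vertices are labelled by generators (a vertex labelled $\mu$ has $\mathrm{ar}(\mu)$ inputs) and whose $n$ leaves are numbered bijectively by an initial segment of length $n$ of the integers; it is drawn in the plane so that at each vertex the inputs are ordered by the minimal leaf reachable through them. Shuffle monomials of arity $n$ form a basis of the component $\mathcal F(n)$ of the free shuffle operad $\mathcal F=\mathcal F(\Upsilon)$. Let $I\subset\mathcal F$ be an ideal (a family of subspaces $I(n)\subset\mathcal F(n)$ closed under shuffle compositions on both sides with elements of $\mathcal F$) and let $\mathcal P=\mathcal F/I$. Fix an admissible order (a well-order of the shuffle monomials of each arity compatible with shuffle compositions). Let $G$ be a finite Gröbner basis of $I$: a finite set of elements of $I$ whose leading monomials generate the ideal spanned by the leading monomials of all nonzero elements of $I$. The *tree skeleton* of a shuffle monomial is the non-planar rooted tree with labelled internal vertices obtained by erasing the leaf numbers. A set of shuffle monomials is *symmetric regular* if with each monomial it contains all shuffle monomials with the same tree skeleton. If all $\dim\mathcal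 P(n)$ are finite, put $E_{\mathcal P}(z)=\sum_{n\ge1}\dim\mathcal P(n)\frac{z^n}{n!}$. If $\deg:\Upsilon\to\mathbb Z_{\ge0}$ is a grading for which $I$ is homogeneous and all $\dim \mathcal P(n)_e$ are finite, put $E_{\mathcal P}(z,t)=\sum_{n\ge1}\sum_{e\ge0}\dim\mathcal P(n)_e\,t^e\frac{z^n}{n!}$. For power series $f,g$ in $z$ let $C(f,g)=\int_0^z f'(w)g(w)\,dw$, $C(f_1,\dots,f_d)=C(f_1,C(f_2,\dots,f_d))$ for $d>2$, and $C(f)=f$. **Theorem.** Suppose that the set of leading monomials of $G$ is symmetric regular, or that the set of leading monomials of all nonzero elements of $I$ is symmetric regular. Then there are integers $M,N\ge0$, generators $\mu_1,\dots,\mu_N\in\Upsilon$ of arities $d_j=\mathrm{ar}(\mu_j)$, a map $\pi$ from $\{0,\dots,M\}$ onto $\{0,\dots,N\}$ with $\pi^{-1}(0)=\{0\}$, numbers $p^i_s\in\{0,1\}$ ($1\le i\le M$, $s\in[0..M]^{d_{\pi(i)}}$), numbers $q^j_s\in\{0,1\}$ ($1\le j\le N$, $s\in[0..N]^{d_j}$)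 and nonnegative integers $m_0,\dots,m_N$ (all of them independent of any grading), such that $q^j_s$ is invariant under permutations of the entries of $s$, and $$q^j_{\pi(s_1),\dots,\pi(s_{d_j})}=\sum_{i:\ \pi(i)=j}p^i_s\qquad\text{for all } 1\le j\le N,\ s\in[0..M]^{d_j},$$ and the following holds. 1. For each grading $\deg$ as above put $a_j=\deg\mu_j$. The integral system $$x_0=z,\qquad x_i=t^{a_{\pi(i)}}\sum_{s\in[0..M]^{d_{\pi(i)}}}p^i_s\,C(x_{s_1},\dots,x_{s_{d_{\pi(i)}}})\qquad(1\le i\le M)$$ has a unique solution in $\mathbb Q[[t]][[z]]$ with $x_i|_{z=0}=0$ for all $i$. It reduces to an algebraic system: the series $y_j=\sum_{\pi(i)=j}x_i$ are the unique solution with $y_j|_{z=0}=0$ for all $j$ of $$y_0=z,\qquad y_j=t^{a_j}\frac1{d_j!}\sum_{s\in[0..N]^{d_j}}q^j_s\;y_{s_1}\cdots y_{s_{d_j}}\qquad(1\le j\le N),$$ they have nonnegative coefficients, and $E_{\mathcal P}(z,t)=m_0y_0+m_1y_1+\dots+m_Ny_N$. 2. If all $\dim\mathcal P(n)$ are finite,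 the same holds in one variable: with all the powers of $t$ replaced by $1$, in $\mathbb Q[[z]]$, and with $E_{\mathcal P}(z)$ in place of $E_{\mathcal P}(z,t)$. Consequently, if all $\dim\mathcal P(n)$ are finite, $E_{\mathcal P}(z)$ is an algebraic function, i.e. algebraic over $\mathbb Q[z]$; and for every grading as above there is a nonzero polynomial $Q\in\mathbb Q[z,t,w]$ with $Q(z,t,E_{\mathcal P}(z,t))=0$. -/

import Mathlib

noncomputable section

/-! ### Tree monomials -/

/-- Planar rooted trees whose internal vertices are labelled by generators `u : Υ` (a vertex labelled
`u` has `ar u` ordered inputs) and whose leaves are labelled by natural numbers. -/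
inductive PTree {Υ : Type*} (ar : Υ → ℕ) : Type _
  | leaf (i : ℕ) : PTree ar
  | node (u : Υ) (c : Fin (ar u) → PTree ar) : PTree ar

namespace PTree

variable {Υ : Type*} {ar : Υ → ℕ}

/-- The multiset of leaf labels. -/
def labels : PTree ar → Multiset ℕ
  | leaf i => {i}
  | node _ c => ∑ j, (c j).labels

/-- The smallest leaf label. -/
def minLabel (t : PTree ar) : ℕ := sInf {i | i ∈ t.labels}

/-- At each vertex the inputs are ordered by the minimal leaf that can be reached through them
(canonical planar realization). -/
def Ordered : PTree ar → Prop
  | leaf _ => True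
  | node _ c => (∀ j, (c j).Ordered) ∧ StrictMono fun j => (c j).minLabel

/-- Shuffle monomials of arity `n`, in canonical planar realization; the leaves are
numbered by `0, …, n - 1`, each number being used once. -/
def IsMon (n : ℕ) (t : PTree ar) : Prop :=
  t.labels = Multiset.range n ∧ t.Ordered

/-- Total degree of a tree, for a grading `deg` of the generators. -/
def degree (deg : Υ → ℕ) : PTree ar → ℕ
  | leaf _ => 0
  | node u c => deg u + ∑ j, (c j).degree deg

/-- Two trees have the same tree skeleton: after erasing the leaf labels they are isomorphic as
non-planar rooted trees with labelled internal vertices. -/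
inductive SameSkeleton : PTree ar → PTree ar → Prop
  | leaf (i j : ℕ) : SameSkeleton (leaf i) (leaf j)
  | node (u : Υ) (c c' : Fin (ar u) → PTree ar) (σ : Equiv.Perm (Fin (ar u)))
      (h : ∀ j, SameSkeleton (c j) (c' (σ j))) : SameSkeleton (node u c) (node u c')

/-- Grafting: every leaf labelled `i` is replaced by the tree `f i`. -/
def bind : PTree ar → (ℕ → PTree ar) → PTree ar
  | leaf i, f => f i
  | node u c, f => node u fun j => (c j).bind f

/-- The leaf `i` of `v` is replaced by `w`; the other leaves of `v` are renumbered by `φ`, and the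
leaves of `w` are renumbered by `ψ`. -/
def shuffleComp (φ ψ : ℕ → ℕ) (i : ℕ) (v w : PTree ar) : PTree ar :=
  v.bind fun j => if j = i then w.bind fun l => leaf (ψ l) else leaf (φ j)

end PTree

/-- The renumberings that are allowed in a shuffle composition, at input `i`, of an operation of
arity `m` with an operation of arity `l`: both are increasing, the numbers `0, …, m + l - 2` are
distributed among the inputs, and the number which `φ` attaches to the input `i` is the
least number of a leaf of the inserted operation. -/
structure IsShuffle (m l i : ℕ) (φ ψ : ℕ → ℕ) : Prop where
  lt : i < m
  pos : 0 < l
  mono_left : StrictMonoOn φ (Set.Iio m)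
  mono_right : StrictMonoOn ψ (Set.Iio l)
  min_eq : ψ 0 = φ i
  inter : φ '' Set.Iio m ∩ ψ '' Set.Iio l = {φ i}
  union : φ '' Set.Iio m ∪ ψ '' Set.Iio l = Set.Iio (m + l - 1)

/-! ### The free shuffle operad, its ideals and its quotients -/

/-- The component of arity `n` of the free shuffle operad: linear combinations of
shuffle monomials of arity `n`. -/
def freeComponent (k : Type*) [Field k] {Υ : Type*} (ar : Υ → ℕ) (n : ℕ) :
    Submodule k (PTree ar →₀ k) :=
  Finsupp.supported k k {t | t.IsMon n}

/-- The part of degree `e` of the component of arity `n` of the free shuffle operad, for a grading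
of the generators. -/
def freeGradedComponent (k : Type*) [Field k] {Υ : Type*} (ar : Υ → ℕ) (deg : Υ → ℕ) (n e : ℕ) :
    Submodule k (PTree ar →₀ k) :=
  Finsupp.supported k k {t | t.IsMon n ∧ t.degree deg = e}

/-- Ideals of the free shuffle operad: families of subspaces of the components that are closed under
all shuffle compositions, on either side, with elements of the free operad (by
bilinearity, with monomials). -/
structure ShuffleIdeal (k : Type*) [Field k] {Υ : Type*} (ar : Υ → ℕ) where
  carrier : ℕ → Submodule k (PTree ar →₀ k)
  le_free : ∀ n, carrier n ≤ freeComponent k ar n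
  comp_left : ∀ {m l i : ℕ} {φ ψ : ℕ → ℕ}, IsShuffle m l i φ ψ →
    ∀ f ∈ carrier m, ∀ w : PTree ar, w.IsMon l →
      Finsupp.lmapDomain k k (fun v => PTree.shuffleComp φ ψ i v w) f ∈ carrier (m + l - 1)
  comp_right : ∀ {m l i : ℕ} {φ ψ : ℕ → ℕ}, IsShuffle m l i φ ψ →
    ∀ g ∈ carrier l, ∀ v : PTree ar, v.IsMon m →
      Finsupp.lmapDomain k k (fun w => PTree.shuffleComp φ ψ i v w) g ∈ carrier (m + l - 1)

namespace ShuffleIdeal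

variable {k : Type*} [Field k] {Υ : Type*} {ar : Υ → ℕ}

/-- All elements of an ideal. -/
def elements (I : ShuffleIdeal k ar) : Set (PTree ar →₀ k) := {f | ∃ n, f ∈ I.carrier n}

/-- The component of arity `n` of the quotient `P` of the free shuffle operad by an ideal: the
component `F(n)` of the free operad modulo `I(n)`, as the image of `F(n)` under the
quotient map by `I(n)`. -/
def quotientComponent (I : ShuffleIdeal k ar) (n : ℕ) : Submodule k ((PTree ar →₀ k) ⧸ I.carrier n) :=
  (freeComponent k ar n).map (I.carrier n).mkQ

/-- The part of arity `n` and degree `e` of the quotient by a homogeneous ideal: the image of the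
part of degree `e` of `F(n)`. -/
def gradedQuotientComponent (I : ShuffleIdeal k ar) (deg : Υ → ℕ) (n e : ℕ) :
    Submodule k ((PTree ar →₀ k) ⧸ I.carrier n) :=
  (freeGradedComponent k ar deg n e).map (I.carrier n).mkQ

/-- Homogeneity: an ideal contains the homogeneous parts of its elements. -/
def IsHomogeneous (I : ShuffleIdeal k ar) (deg : Υ → ℕ) : Prop :=
  ∀ n, ∀ f ∈ I.carrier n, ∀ e, f.filter (fun t => t.degree deg = e) ∈ I.carrier n

/-- The exponential generating series `∑ dim P(n) z ^ n / n!` of the quotient operad. -/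
def expSeries (I : ShuffleIdeal k ar) : PowerSeries ℚ :=
  PowerSeries.mk fun n => (Module.finrank k (I.quotientComponent n) : ℚ) / n.factorial

/-- The two-variable series `∑ dim P(n)_e t ^ e z ^ n / n!` of the quotient operad, as a power
series in `z` whose coefficients are power series in `t`. -/
def expSeries₂ (I : ShuffleIdeal k ar) (deg : Υ → ℕ) : PowerSeries (PowerSeries ℚ) :=
  PowerSeries.mk fun n => PowerSeries.mk fun e =>
    (Module.finrank k (I.gradedQuotientComponent deg n e) : ℚ) / n.factorial

end ShuffleIdeal

/-- The ideal generated by a set of shuffle monomials, in arity `n`. -/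
def monomialIdealSpan (k : Type*) [Field k] {Υ : Type*} {ar : Υ → ℕ} (S : Set (PTree ar)) (n : ℕ) :
    Submodule k (PTree ar →₀ k) :=
  sInf {V | ∃ J : ShuffleIdeal k ar,
    (∀ m, ∀ v ∈ S, v.IsMon m → Finsupp.single v 1 ∈ J.carrier m) ∧ V = J.carrier n}

/-! ### Admissible orders and Gröbner bases -/

/-- Admissible orders: a well-order of the shuffle monomials of each arity that is compatible with
all shuffle compositions. -/
structure AdmissibleOrder {Υ : Type*} (ar : Υ → ℕ) where
  lt : PTree ar → PTree ar → Prop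
  irrefl : ∀ n v, v.IsMon n → ¬ lt v v
  trans : ∀ n u v w, u.IsMon n → v.IsMon n → w.IsMon n → lt u v → lt v w → lt u w
  total : ∀ n v w, v.IsMon n → w.IsMon n → lt v w ∨ v = w ∨ lt w v
  wf : ∀ n, Set.WellFoundedOn {v : PTree ar | v.IsMon n} lt
  comp_left : ∀ {m l i : ℕ} {φ ψ : ℕ → ℕ}, IsShuffle m l i φ ψ →
    ∀ v v' w : PTree ar, v.IsMon m → v'.IsMon m → w.IsMon l → lt v v' →
      lt (PTree.shuffleComp φ ψ i v w) (PTree.shuffleComp φ ψ i v' w)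
  comp_right : ∀ {m l i : ℕ} {φ ψ : ℕ → ℕ}, IsShuffle m l i φ ψ →
    ∀ v w w' : PTree ar, v.IsMon m → w.IsMon l → w'.IsMon l → lt w w' →
      lt (PTree.shuffleComp φ ψ i v w) (PTree.shuffleComp φ ψ i v w')

section Groebner

variable {k : Type*} [Field k] {Υ : Type*} {ar : Υ → ℕ}

/-- The set of leading monomials of the nonzero elements of `G`. -/
def leadingMonomials (O : AdmissibleOrder ar) (G : Set (PTree ar →₀ k)) : Set (PTree ar) :=
  {v | ∃ g ∈ G, v ∈ g.support ∧ ∀ w ∈ g.support, w ≠ v → O.lt w v}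

/-- A Gröbner basis of an ideal: a set of its elements whose leading monomials generate the
ideal that is spanned by the leading monomials of all elements of the ideal. -/
def IsGroebnerBasis (O : AdmissibleOrder ar) (I : ShuffleIdeal k ar) (G : Set (PTree ar →₀ k)) :
    Prop :=
  G ⊆ I.elements ∧ ∀ n, monomialIdealSpan k (leadingMonomials O G) n =
    Submodule.span k {f | ∃ v ∈ leadingMonomials O I.elements, v.IsMon n ∧ f = Finsupp.single v 1}

/-- With each monomial, a symmetric regular set contains all shuffle monomials with the same tree
skeleton. -/
def SymmetricRegular (S : Set (PTree ar)) : Prop :=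
  ∀ v ∈ S, ∀ n, ∀ w : PTree ar, w.IsMon n → v.SameSkeleton w → w ∈ S

end Groebner

/-! ### Systems of equations -/

section Systems

variable {R : Type*} [CommRing R] [Algebra ℚ R]

/-- `C(f, g) = ∫₀ᶻ f'(w) g(w) dw`. -/
def shuffleProd (f g : PowerSeries R) : PowerSeries R :=
  PowerSeries.mk fun n =>
    (n : ℚ)⁻¹ • PowerSeries.coeff (n - 1) (PowerSeries.derivative R f * g)

/-- `C(f₁, …, f_d) = C(f₁, C(f₂, …, f_d))`, with `C(f) = f`. -/
def shuffleProdList : List (PowerSeries R) → PowerSeries R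
  | [] => 1
  | [f] => f
  | f :: g :: l => shuffleProd f (shuffleProdList (g :: l))

variable {Υ : Type*} (ar : Υ → ℕ)

/-- The integral system `y₀ = z`, `yᵢ = t ^ aᵢ ∑ₛ q i s C(y_{s 1}, …, y_{s dᵢ})` for `i = 1, …, N`,
with `yᵢ(0) = 0`; here `dᵢ` and `aᵢ` are the arity and the degree of the generator `root i`. -/
def SolvesIntegralSystem (t : R) (deg : Υ → ℕ) {N : ℕ} (root : Fin N → Υ)
    (q : ∀ i, (Fin (ar (root i)) → Fin (N + 1)) → ℕ) (y : Fin (N + 1) → PowerSeries R) : Prop :=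
  y 0 = PowerSeries.X ∧ (∀ i, PowerSeries.constantCoeff (y i) = 0) ∧
    ∀ i : Fin N, y i.succ = PowerSeries.C (t ^ deg (root i)) *
      ∑ s, q i s • shuffleProdList (List.ofFn fun j => y (s j))

/-- The algebraic system `y₀ = z`, `yᵢ = t ^ aᵢ (1 / dᵢ!) ∑ₛ q i s y_{s 1} ⋯ y_{s dᵢ}` for
`i = 1, …, N`, with `yᵢ(0) = 0`. -/
def SolvesAlgebraicSystem (t : R) (deg : Υ → ℕ) {N : ℕ} (root : Fin N → Υ)
    (q : ∀ i, (Fin (ar (root i)) → Fin (N + 1)) → ℕ) (y : Fin (N + 1) → PowerSeries R) : Prop :=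
  y 0 = PowerSeries.X ∧ (∀ i, PowerSeries.constantCoeff (y i) = 0) ∧
    ∀ i : Fin N, y i.succ = PowerSeries.C (t ^ deg (root i)) *
      (((ar (root i)).factorial : ℚ)⁻¹ • ∑ s, q i s • ∏ j, y (s j))

/-- Extension of a map of indices `1, …, M` to `1, …, N` by `0 ↦ 0`. -/
def extendZero {M N : ℕ} (π : Fin M → Fin N) : Fin (M + 1) → Fin (N + 1) :=
  Fin.cases 0 fun i => (π i).succ

/-- The integral system with coefficients `p` (and generators `root (π i)`) reduces to the algebraic
system with coefficients `q` by merging the unknowns along `π`: the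
coefficients `q` are symmetric, and the `j`-th equation collects the equations `i` with
`π i = j`. -/
def CoefficientsReduce {M N : ℕ} (root : Fin N → Υ) (π : Fin M → Fin N)
    (p : ∀ i, (Fin (ar (root (π i))) → Fin (M + 1)) → ℕ)
    (q : ∀ j, (Fin (ar (root j)) → Fin (N + 1)) → ℕ) : Prop :=
  (∀ j s (σ : Equiv.Perm (Fin (ar (root j)))), q j (s ∘ σ) = q j s) ∧
    ∀ j (s : Fin (ar (root j)) → Fin (M + 1)), q j (extendZero π ∘ s) =
      ∑ i : {i : Fin M // π i = j}, p i.1 (s ∘ Fin.cast (congrArg (fun l => ar (root l)) i.2))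

/-- `x` is the unique solution of the integral system, `y` is the unique solution of the algebraic
system, and `y` arises from `x` by adding up the unknowns that `π` merges. -/
def SolutionsReduce (t : R) (deg : Υ → ℕ) {M N : ℕ} (root : Fin N → Υ) (π : Fin M → Fin N)
    (p : ∀ i, (Fin (ar (root (π i))) → Fin (M + 1)) → ℕ)
    (q : ∀ j, (Fin (ar (root j)) → Fin (N + 1)) → ℕ)
    (x : Fin (M + 1) → PowerSeries R) (y : Fin (N + 1) → PowerSeries R) : Prop :=
  SolvesIntegralSystem ar t deg (fun i => root (π i)) p x ∧
    (∀ x', SolvesIntegralSystem ar t deg (fun i => root (π i)) p x' → x' = x) ∧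
    SolvesAlgebraicSystem ar t deg root q y ∧
    (∀ y', SolvesAlgebraicSystem ar t deg root q y' → y' = y) ∧
    ∀ j, y j = ∑ i with extendZero π i = j, x i

end Systems

end

/-! The leading monomials of `I` span an ideal of the free shuffle operad, so they are closed under
shuffle compositions. Symmetric regularity makes membership independent of the numbering of the
leaves: a monomial is leading exactly when one of a set of skeletons of bounded height occurs in it
as a non-planar subtree (`exists_contains_iff`). One direction holds because the monomials with an
occurrence span an ideal. For the other, the tree is rebuilt from the occurrence by grafting
subtrees one at a time, each grafting being a shuffle composition up to an increasing renumbering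
(`std_graft`, `Contains.std_mem`).

Avoiding skeletons of bounded height can be recognized by a finite tree automaton. Its states are
the skeletons cut off at a fixed height; the state and the normality of a tree depend only on its
root and the unordered collection of the states of its branches (`avoiding`). The monomials that are
not leading form bases of the components of the quotient, so the dimensions count normal trees. The
least leaf of a tuple of trees ordered by least leaves lies in the first tree. Hence such tuples are
counted by iterated operations `C(f, g)`, whose derivative `f' g` marks that leaf
(`hasSeries_forests`), and the series of the classes solve the integral system (`series_succ`).

The coefficients are symmetric since skeletons are non-planar. Because the sum of the operations `C`
over all orders of the arguments is the ordinary product (`sum_perm_shuffleProdList`), the integral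
and the algebraic system have the same solutions. One may therefore take `M = N`, `π = id` and `p =
q`.

Uniqueness and algebraicity both come from the Jacobian determinant. At `z = t = 0` only unary
generators of degree zero contribute to the linear part. A nonzero entry in a high power of this
matrix would give trees of arbitrarily large height with fixed arity and degree, against finite
dimensionality. So the matrix is nilpotent and the determinant is a unit (`isUnit_det_rat`). The
difference of two solutions is then killed by a unit. The Kähler differentials of the field
generated by a solution vanish, so this field is separable algebraic (`isAlgebraic_of_system`). -/

noncomputable section

open Finset

/-! ### Ranks in finite sets of natural numbers -/

/-- The number of elements of `V` below `a`. -/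
def rankIn (V : Finset ℕ) (a : ℕ) : ℕ := #{b ∈ V | b < a}

/-- The element of `V` of a given rank. -/
def unrankIn (V : Finset ℕ) : ℕ → ℕ := Function.invFunOn (rankIn V) V

theorem rankIn_strictMonoOn (V : Finset ℕ) : StrictMonoOn (rankIn V) V := by
  intro a ha b hb hab
  apply card_lt_card
  rw [ssubset_iff_of_subset]
  · exact ⟨a, by simpa using ⟨ha, hab⟩, by simp⟩
  · intro c
    simp only [mem_filter]
    exact fun h => ⟨h.1, h.2.trans hab⟩

theorem rankIn_lt {V : Finset ℕ} {a : ℕ} (ha : a ∈ V) : rankIn V a < #V := by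
  apply card_lt_card
  rw [ssubset_iff_of_subset (filter_subset _ _)]
  exact ⟨a, ha, by simp⟩

theorem image_rankIn (V : Finset ℕ) : V.image (rankIn V) = range #V := by
  apply eq_of_subset_of_card_le
  · intro a
    simp only [mem_image, mem_range]
    rintro ⟨b, hb, rfl⟩
    exact rankIn_lt hb
  · rw [card_image_of_injOn (rankIn_strictMonoOn V).injOn, card_range]

theorem image_rankIn_coe (V : Finset ℕ) : rankIn V '' V = Set.Iio #V := by
  rw [← coe_image, image_rankIn, coe_range]

theorem unrankIn_mem {V : Finset ℕ} {n : ℕ} (hn : n < #V) : unrankIn V n ∈ V := by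
  have : n ∈ V.image (rankIn V) := by rw [image_rankIn]; simpa using hn
  obtain ⟨a, ha, rfl⟩ := mem_image.1 this
  exact Function.invFunOn_mem ⟨a, ha, rfl⟩

theorem rankIn_unrankIn {V : Finset ℕ} {n : ℕ} (hn : n < #V) : rankIn V (unrankIn V n) = n := by
  have : n ∈ V.image (rankIn V) := by rw [image_rankIn]; simpa using hn
  obtain ⟨a, ha, rfl⟩ := mem_image.1 this
  exact Function.invFunOn_eq ⟨a, ha, rfl⟩

theorem unrankIn_rankIn {V : Finset ℕ} {a : ℕ} (ha : a ∈ V) : unrankIn V (rankIn V a) = a :=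
  (rankIn_strictMonoOn V).injOn (unrankIn_mem (rankIn_lt ha)) ha (rankIn_unrankIn (rankIn_lt ha))

theorem unrankIn_strictMonoOn (V : Finset ℕ) : StrictMonoOn (unrankIn V) (Set.Iio #V) := by
  intro a ha b hb hab
  rw [← (rankIn_strictMonoOn V).lt_iff_lt (unrankIn_mem ha) (unrankIn_mem hb),
    rankIn_unrankIn ha, rankIn_unrankIn hb]
  exact hab

theorem rankIn_min {V : Finset ℕ} {a : ℕ} (h : ∀ b ∈ V, a ≤ b) : rankIn V a = 0 := by
  rw [rankIn, card_eq_zero, filter_eq_empty_iff]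
  exact fun b hb => not_lt.2 (h b hb)

theorem image_unrankIn_coe (V : Finset ℕ) : unrankIn V '' Set.Iio #V = V := by
  ext a
  constructor
  · rintro ⟨n, hn, rfl⟩
    exact unrankIn_mem hn
  · exact fun ha => ⟨rankIn V a, rankIn_lt ha, unrankIn_rankIn ha⟩

theorem rankIn_range {n a : ℕ} (h : a < n) : rankIn (range n) a = a := by
  have : ({b ∈ range n | b < a} : Finset ℕ) = range a := by
    ext b
    simp only [mem_filter, mem_range]
    omega
  rw [rankIn, this, card_range]

namespace PTree

variable {Υ : Type*} {ar : Υ → ℕ}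

/-! ### Grafting -/

theorem bind_bind (t : PTree ar) (f g : ℕ → PTree ar) :
    (t.bind f).bind g = t.bind fun i => (f i).bind g := by
  induction t with
  | leaf i => rfl
  | node u c ih => simp only [bind, ih]

theorem bind_leaf (t : PTree ar) : t.bind leaf = t := by
  induction t with
  | leaf i => rfl
  | node u c ih => simp only [bind, ih]

theorem mem_labels_node {u : Υ} {c : Fin (ar u) → PTree ar} {a : ℕ} :
    a ∈ (node u c).labels ↔ ∃ j, a ∈ (c j).labels := by
  simp [labels, Multiset.mem_sum]

theorem bind_congr {t : PTree ar} {f g : ℕ → PTree ar} (h : ∀ a ∈ t.labels, f a = g a) :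
    t.bind f = t.bind g := by
  induction t with
  | leaf i => exact h i (by simp [labels])
  | node u c ih =>
    simp only [bind]
    congr 1
    funext j
    exact ih j fun a ha => h a (mem_labels_node.2 ⟨j, ha⟩)

theorem labels_bind (t : PTree ar) (f : ℕ → PTree ar) :
    (t.bind f).labels = t.labels.bind fun i => (f i).labels := by
  induction t with
  | leaf i => simp [bind, labels]
  | node u c ih =>
    simp only [bind, labels, ih]
    let F : Multiset ℕ →+ Multiset ℕ :=
      ⟨⟨fun s => s.bind fun i => (f i).labels, Multiset.zero_bind _⟩,
        fun s s' => Multiset.add_bind s s' _⟩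
    exact (map_sum F (fun j => (c j).labels) univ).symm

theorem mem_labels_bind {t : PTree ar} {f : ℕ → PTree ar} {a : ℕ} :
    a ∈ (t.bind f).labels ↔ ∃ b ∈ t.labels, a ∈ (f b).labels := by
  rw [labels_bind, Multiset.mem_bind]

theorem exists_mem_labels (har : ∀ u, 0 < ar u) (t : PTree ar) : ∃ a, a ∈ t.labels := by
  induction t with
  | leaf i => exact ⟨i, by simp [labels]⟩
  | node u c ih =>
    obtain ⟨a, ha⟩ := ih ⟨0, har u⟩
    exact ⟨a, mem_labels_node.2 ⟨_, ha⟩⟩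

theorem minLabel_mem (har : ∀ u, 0 < ar u) (t : PTree ar) : t.minLabel ∈ t.labels :=
  Nat.sInf_mem (s := {i | i ∈ t.labels}) (exists_mem_labels har t)

theorem minLabel_le {t : PTree ar} {a : ℕ} (ha : a ∈ t.labels) : t.minLabel ≤ a :=
  Nat.sInf_le (s := {i | i ∈ t.labels}) ha

theorem minLabel_eq {t : PTree ar} {a : ℕ} (ha : a ∈ t.labels) (h : ∀ b ∈ t.labels, a ≤ b) :
    t.minLabel = a :=
  le_antisymm (minLabel_le ha) (le_csInf ⟨a, ha⟩ h)

@[simp] theorem minLabel_leaf (i : ℕ) : (leaf i : PTree ar).minLabel = i :=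
  minLabel_eq (by simp [labels]) (by simp [labels])

theorem minLabel_bind (har : ∀ u, 0 < ar u) {t : PTree ar} {f : ℕ → PTree ar} {φ : ℕ → ℕ}
    (hφ : StrictMonoOn φ {a | a ∈ t.labels}) (h : ∀ a ∈ t.labels, (f a).minLabel = φ a) :
    (t.bind f).minLabel = φ t.minLabel := by
  have hm := minLabel_mem har t
  apply minLabel_eq
  · rw [mem_labels_bind]
    exact ⟨_, hm, h _ hm ▸ minLabel_mem har _⟩
  · intro b hb
    obtain ⟨a, ha, hab⟩ := mem_labels_bind.1 hb
    exact (hφ.monotoneOn hm ha (minLabel_le ha)).trans (h a ha ▸ minLabel_le hab)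

/-- Planarity involves only comparisons of least labels, and grafting changes the least labels below
every old vertex by the one increasing map `φ`. Hence the order there is both preserved and
reflected. -/
theorem ordered_bind_iff (har : ∀ u, 0 < ar u) {t : PTree ar} {f : ℕ → PTree ar} {φ : ℕ → ℕ}
    (hφ : StrictMonoOn φ {a | a ∈ t.labels}) (h : ∀ a ∈ t.labels, (f a).minLabel = φ a) :
    (t.bind f).Ordered ↔ t.Ordered ∧ ∀ a ∈ t.labels, (f a).Ordered := by
  induction t with
  | leaf i => simp [bind, labels, Ordered]
  | node u c ih =>
    have hs : ∀ j a, a ∈ (c j).labels → a ∈ (node u c).labels :=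
      fun j a ha => mem_labels_node.2 ⟨j, ha⟩
    have hφ' : ∀ j, StrictMonoOn φ {a | a ∈ (c j).labels} := fun j => hφ.mono fun a ha => hs j a ha
    have ih' := fun j => ih j (hφ' j) fun a ha => h a (hs j a ha)
    have hmin : ∀ j, ((c j).bind f).minLabel = φ (c j).minLabel :=
      fun j => minLabel_bind har (hφ' j) fun a ha => h a (hs j a ha)
    have hmono : (StrictMono fun j => ((c j).bind f).minLabel) ↔
        StrictMono fun j => (c j).minLabel := by
      simp only [hmin]
      constructor
      · intro H i j hij
        exact (hφ.lt_iff_lt (hs i _ (minLabel_mem har _)) (hs j _ (minLabel_mem har _))).1 (H hij)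
      · intro H i j hij
        exact (hφ.lt_iff_lt (hs i _ (minLabel_mem har _)) (hs j _ (minLabel_mem har _))).2 (H hij)
    simp only [bind, Ordered, ih', hmono]
    constructor
    · rintro ⟨h1, h2⟩
      refine ⟨⟨fun j => (h1 j).1, h2⟩, fun a ha => ?_⟩
      obtain ⟨j, hj⟩ := mem_labels_node.1 ha
      exact (h1 j).2 a hj
    · rintro ⟨⟨h1, h2⟩, h3⟩
      exact ⟨fun j => ⟨h1 j, fun a ha => h3 a (hs j a ha)⟩, h2⟩

/-- Renumbering of the leaves. -/
def relabel (φ : ℕ → ℕ) (t : PTree ar) : PTree ar := t.bind fun a => leaf (φ a)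

theorem labels_relabel (φ : ℕ → ℕ) (t : PTree ar) : (t.relabel φ).labels = t.labels.map φ := by
  rw [relabel, labels_bind]
  simp only [labels, Multiset.bind_singleton]

theorem relabel_relabel (φ ψ : ℕ → ℕ) (t : PTree ar) :
    (t.relabel φ).relabel ψ = t.relabel (ψ ∘ φ) := by
  simp only [relabel, bind_bind, bind, Function.comp]

theorem relabel_eq_self {φ : ℕ → ℕ} {t : PTree ar} (h : ∀ a ∈ t.labels, φ a = a) :
    t.relabel φ = t := by
  conv_rhs => rw [← bind_leaf t]
  exact bind_congr fun a ha => by rw [h a ha]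

theorem ordered_relabel_iff (har : ∀ u, 0 < ar u) {φ : ℕ → ℕ} {t : PTree ar}
    (hφ : StrictMonoOn φ {a | a ∈ t.labels}) : (t.relabel φ).Ordered ↔ t.Ordered := by
  rw [relabel, ordered_bind_iff har hφ fun a _ => minLabel_leaf _]
  simp [Ordered]

/-- Degree of a renumbered tree. -/
theorem degree_relabel (deg : Υ → ℕ) (φ : ℕ → ℕ) (t : PTree ar) :
    (t.relabel φ).degree deg = t.degree deg := by
  induction t with
  | leaf i => rfl
  | node u c ih =>
    simp only [relabel] at ih
    simp only [relabel, bind, degree, ih]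

/-! ### Standardization -/

/-- Trees in canonical planar realization with pairwise different leaf labels. -/
def Good (t : PTree ar) : Prop := t.Ordered ∧ t.labels.Nodup

/-- The tree with the leaf labels replaced by their ranks. -/
def std (t : PTree ar) : PTree ar := t.relabel (rankIn t.labels.toFinset)

theorem strictMonoOn_rankIn_labels (t : PTree ar) :
    StrictMonoOn (rankIn t.labels.toFinset) {a | a ∈ t.labels} :=
  (rankIn_strictMonoOn _).mono fun a ha => by simpa using ha

theorem card_toFinset_labels {t : PTree ar} (h : t.labels.Nodup) :
    #t.labels.toFinset = t.labels.card := by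
  rw [Finset.card, Multiset.toFinset_val, h.dedup]

theorem labels_eq_range {t : PTree ar} {n : ℕ} (hn : t.labels.Nodup)
    (h : ∀ a, a ∈ t.labels ↔ a < n) : t.labels = Multiset.range n :=
  (Multiset.Nodup.ext hn (Multiset.nodup_range n)).2 fun a => by rw [h, Multiset.mem_range]

theorem Good.isMon_std (har : ∀ u, 0 < ar u) {t : PTree ar} (h : t.Good) :
    (std t).IsMon t.labels.card := by
  refine ⟨labels_eq_range ?_ fun a => ?_, ?_⟩
  · rw [std, labels_relabel]
    exact Multiset.Nodup.map_on (fun a ha b hb hab =>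
      (strictMonoOn_rankIn_labels t).injOn ha hb hab) h.2
  · have := image_rankIn t.labels.toFinset
    rw [card_toFinset_labels h.2] at this
    rw [std, labels_relabel, ← mem_range, ← this]
    simp
  · exact (ordered_relabel_iff har (strictMonoOn_rankIn_labels t)).2 h.1

theorem IsMon.good {n : ℕ} {t : PTree ar} (h : t.IsMon n) : t.Good :=
  ⟨h.2, h.1 ▸ Multiset.nodup_range n⟩

theorem IsMon.mem_labels {n a : ℕ} {t : PTree ar} (h : t.IsMon n) : a ∈ t.labels ↔ a < n := by
  rw [h.1, Multiset.mem_range]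

theorem IsMon.std_eq {n : ℕ} {t : PTree ar} (h : t.IsMon n) : std t = t := by
  apply relabel_eq_self
  intro a ha
  have : (Multiset.range n).toFinset = range n := by ext; simp
  rw [h.1, this, rankIn_range (h.mem_labels.1 ha)]

theorem IsMon.eq {m n : ℕ} {t : PTree ar} (h : t.IsMon m) (h' : t.IsMon n) : m = n := by
  have := congrArg Multiset.card (h.1.symm.trans h'.1)
  simpa using this

theorem IsMon.pos (har : ∀ u, 0 < ar u) {n : ℕ} {t : PTree ar} (h : t.IsMon n) : 0 < n := by
  obtain ⟨a, ha⟩ := exists_mem_labels har t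
  exact (Nat.zero_le a).trans_lt (h.mem_labels.1 ha)

theorem IsMon.minLabel (har : ∀ u, 0 < ar u) {n : ℕ} {t : PTree ar} (h : t.IsMon n) :
    t.minLabel = 0 :=
  minLabel_eq (h.mem_labels.2 (h.pos har)) fun _ _ => Nat.zero_le _

theorem nodup_bind {t : PTree ar} {f : ℕ → PTree ar} (ht : t.labels.Nodup)
    (hf : ∀ a ∈ t.labels, (f a).labels.Nodup)
    (hd : ∀ a ∈ t.labels, ∀ b ∈ t.labels, ∀ x ∈ (f a).labels, x ∈ (f b).labels → a = b) :
    (t.bind f).labels.Nodup := by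
  rw [labels_bind, Multiset.nodup_bind]
  exact ⟨hf, Multiset.Nodup.pairwise (fun a ha b hb hab => Multiset.disjoint_left.2
    fun hx hx' => hab (hd a ha b hb _ hx hx')) ht⟩

/-- The shuffle conditions make the two sets of new numbers overlap only in `φ i` and fill an
initial segment. Since `ψ 0 = φ i`, the inserted tree has the least label prescribed by `φ`, so
`ordered_bind_iff` gives planarity. -/
theorem isMon_shuffleComp (har : ∀ u, 0 < ar u) {m l i : ℕ} {φ ψ : ℕ → ℕ} (h : IsShuffle m l i φ ψ)
    {v w : PTree ar} (hv : v.IsMon m) (hw : w.IsMon l) :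
    (shuffleComp φ ψ i v w).IsMon (m + l - 1) := by
  have hwl : (w.relabel ψ).labels = (Multiset.range l).map ψ := by rw [labels_relabel, hw.1]
  have hmw : StrictMonoOn ψ {a | a ∈ w.labels} :=
    h.mono_right.mono fun a ha => hw.mem_labels.1 ha
  have hmv : StrictMonoOn φ {a | a ∈ v.labels} :=
    h.mono_left.mono fun a ha => hv.mem_labels.1 ha
  have key : shuffleComp φ ψ i v w = v.bind fun j => if j = i then w.relabel ψ else leaf (φ j) := rfl
  have hx : ∀ a < l, ∀ b < m, ψ a = φ b → b = i := by
    intro a ha b hb hab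
    have : φ b ∈ ({φ i} : Set ℕ) := h.inter ▸ ⟨⟨b, hb, rfl⟩, ⟨a, ha, hab⟩⟩
    exact h.mono_left.injOn hb h.lt this
  refine ⟨labels_eq_range ?_ ?_, ?_⟩
  · rw [key]
    apply nodup_bind (hv.good.2)
    · intro a _
      split_ifs
      · rw [hwl]
        exact Multiset.Nodup.map_on (fun a ha b hb hab => h.mono_right.injOn
          (by simpa using ha) (by simpa using hb) hab) (Multiset.nodup_range l)
      · simp [labels]
    · intro a ha b hb x hxa hxb
      rw [hv.mem_labels] at ha hb
      split_ifs at hxa hxb with h1 h2 h2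
      · rw [h1, h2]
      · rw [hwl, Multiset.mem_map] at hxa
        obtain ⟨y, hy, rfl⟩ := hxa
        simp only [labels, Multiset.mem_singleton] at hxb
        exact absurd (hx y (by simpa using hy) b hb hxb) h2
      · rw [hwl, Multiset.mem_map] at hxb
        obtain ⟨y, hy, rfl⟩ := hxb
        simp only [labels, Multiset.mem_singleton] at hxa
        exact absurd (hx y (by simpa using hy) a ha hxa) h1
      · simp only [labels, Multiset.mem_singleton] at hxa hxb
        exact h.mono_left.injOn ha hb (hxa.symm.trans hxb)
  · intro a
    rw [← Set.mem_Iio, ← h.union, key, mem_labels_bind]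
    constructor
    · rintro ⟨b, hb, hab⟩
      split_ifs at hab
      · rw [hwl, Multiset.mem_map] at hab
        obtain ⟨y, hy, rfl⟩ := hab
        exact Or.inr ⟨y, by simpa using hy, rfl⟩
      · simp only [labels, Multiset.mem_singleton] at hab
        exact Or.inl ⟨b, hv.mem_labels.1 hb, hab.symm⟩
    · have hr : ∀ y < l, ∃ b ∈ v.labels,
          ψ y ∈ (if b = i then w.relabel ψ else leaf (φ b)).labels := by
        intro y hy
        refine ⟨i, hv.mem_labels.2 h.lt, ?_⟩
        rw [if_pos rfl, hwl]
        exact Multiset.mem_map_of_mem ψ (by simpa using hy)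
      rintro (⟨b, hb, rfl⟩ | ⟨y, hy, rfl⟩)
      · by_cases hbi : b = i
        · rw [hbi, ← h.min_eq]
          exact hr 0 h.pos
        · exact ⟨b, hv.mem_labels.2 hb, by simp [hbi, labels]⟩
      · exact hr y hy
  · rw [key, ordered_bind_iff har hmv]
    · refine ⟨hv.2, fun a _ => ?_⟩
      split_ifs
      · exact (ordered_relabel_iff har hmw).2 hw.2
      · trivial
    · intro a _
      split_ifs with hai
      · rw [relabel, minLabel_bind har hmw fun a _ => minLabel_leaf _, hw.minLabel har, h.min_eq, hai]
      · exact minLabel_leaf _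

/-- The leaf `i` of `v` is replaced by `w`. -/
def graft (i : ℕ) (v w : PTree ar) : PTree ar := v.bind fun a => if a = i then w else leaf a

theorem mem_labels_graft {i a : ℕ} {v w : PTree ar} (hi : i ∈ v.labels) (hiw : i ∈ w.labels) :
    a ∈ (graft i v w).labels ↔ a ∈ v.labels ∨ a ∈ w.labels := by
  rw [graft, mem_labels_bind]
  constructor
  · rintro ⟨b, hb, hab⟩
    split_ifs at hab
    · exact Or.inr hab
    · simp only [labels, Multiset.mem_singleton] at hab
      exact Or.inl (hab ▸ hb)
  · rintro (ha | ha)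
    · by_cases hai : a = i
      · exact ⟨i, hi, by rw [if_pos rfl, hai]; exact hiw⟩
      · exact ⟨a, ha, by simp [hai, labels]⟩
    · exact ⟨i, hi, by rw [if_pos rfl]; exact ha⟩

/-- The label sets `V` and `W` share only `i`, which is least in `W`. Passing from ranks in `V` or
in `W` to ranks in the union is increasing, and these two maps are the renumberings of the shuffle
composition. -/
theorem std_graft (har : ∀ u, 0 < ar u) {i : ℕ} {v w : PTree ar} (hv : v.Good) (hw : w.Good)
    (hi : i ∈ v.labels) (hmin : w.minLabel = i)
    (hd : ∀ a ∈ v.labels, a ∈ w.labels → a = i) :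
    ∃ φ ψ j, IsShuffle v.labels.card w.labels.card j φ ψ ∧
      std (graft i v w) = shuffleComp φ ψ j (std v) (std w) := by
  have hiw : i ∈ w.labels := hmin ▸ minLabel_mem har w
  set V := v.labels.toFinset with hV
  set W := w.labels.toFinset with hW
  set T := (graft i v w).labels.toFinset with hT
  have hTu : T = V ∪ W := by
    ext a
    simp [hT, hV, hW, mem_labels_graft hi hiw]
  have hVT : V ⊆ T := hTu ▸ subset_union_left
  have hWT : W ⊆ T := hTu ▸ subset_union_right
  have hVW : V ∩ W = {i} := by
    ext a
    simp only [hV, hW, mem_inter, Multiset.mem_toFinset, mem_singleton]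
    exact ⟨fun h => hd a h.1 h.2, fun h => h ▸ ⟨hi, hiw⟩⟩
  have hcV : #V = v.labels.card := card_toFinset_labels hv.2
  have hcW : #W = w.labels.card := card_toFinset_labels hw.2
  have hcT : #T = #V + #W - 1 := by
    have := card_union_add_card_inter V W
    rw [← hTu, hVW, card_singleton] at this
    omega
  have hiV : i ∈ V := by simpa [hV] using hi
  have hiW : i ∈ W := by simpa [hW] using hiw
  have hW0 : rankIn W i = 0 := rankIn_min fun b hb => by
    rw [← hmin]
    exact minLabel_le (by simpa [hW] using hb)
  have hmono : ∀ {U : Finset ℕ}, U ⊆ T → StrictMonoOn (rankIn T ∘ unrankIn U) (Set.Iio #U) :=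
    fun hU => (rankIn_strictMonoOn T).comp (unrankIn_strictMonoOn _) fun n hn => hU (unrankIn_mem hn)
  have himg : ∀ {U : Finset ℕ}, (rankIn T ∘ unrankIn U) '' Set.Iio #U = rankIn T '' U := by
    intro U
    rw [Set.image_comp, image_unrankIn_coe]
  refine ⟨rankIn T ∘ unrankIn V, rankIn T ∘ unrankIn W, rankIn V i, ?_, ?_⟩
  · rw [← hcV, ← hcW]
    refine ⟨rankIn_lt hiV, card_pos.2 ⟨i, hiW⟩, hmono hVT, hmono hWT, ?_, ?_, ?_⟩
    · rw [← hW0, Function.comp, Function.comp, unrankIn_rankIn hiV, unrankIn_rankIn hiW]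
    · rw [himg, himg, Function.comp, unrankIn_rankIn hiV, ← (rankIn_strictMonoOn T).injOn.image_inter
        (by exact_mod_cast hVT) (by exact_mod_cast hWT), ← coe_inter, hVW]
      simp
    · rw [himg, himg, ← Set.image_union, ← coe_union, ← hTu, image_rankIn_coe, hcT]
  · have hmemV : ∀ {a}, a ∈ v.labels → a ∈ V := fun ha => by simpa [hV] using ha
    have hmemW : ∀ {a}, a ∈ w.labels → a ∈ W := fun ha => by simpa [hW] using ha
    have e : std (graft i v w) = (graft i v w).relabel (rankIn T) := rfl
    rw [e, graft, relabel, bind_bind, shuffleComp, std, relabel, bind_bind]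
    refine bind_congr fun a ha => ?_
    by_cases hai : a = i
    · subst hai
      simp only [if_true, bind, std, relabel, bind_bind, ← hV, ← hW]
      refine bind_congr fun b hb => ?_
      simp only [Function.comp]
      rw [unrankIn_rankIn (hmemW hb)]
    · have : rankIn V a ≠ rankIn V i := fun h =>
        hai ((rankIn_strictMonoOn V).injOn (hmemV ha) hiV h)
      simp only [if_neg hai, bind]
      rw [← hV, if_neg this, Function.comp, unrankIn_rankIn (hmemV ha)]

end PTree

end

noncomputable section

open Finset

namespace PTree

variable {Υ : Type*} {ar : Υ → ℕ}

/-! ### Occurrences of skeletons -/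

/-- The skeleton of the first tree occurs at the root of the second one. -/
inductive Matches : PTree ar → PTree ar → Prop
  | leaf (i : ℕ) (t : PTree ar) : Matches (leaf i) t
  | node (u : Υ) (c c' : Fin (ar u) → PTree ar) (σ : Equiv.Perm (Fin (ar u)))
      (h : ∀ j, Matches (c j) (c' (σ j))) : Matches (node u c) (node u c')

/-- The skeleton of an element of `S` occurs somewhere in a tree. -/
inductive Contains (S : Set (PTree ar)) : PTree ar → Prop
  | root (P t : PTree ar) (hP : P ∈ S) (h : Matches P t) : Contains S t
  | child (u : Υ) (c : Fin (ar u) → PTree ar) (j : Fin (ar u)) (h : Contains S (c j)) :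
      Contains S (node u c)

theorem Matches.bind {P t : PTree ar} (h : Matches P t) (f : ℕ → PTree ar) :
    Matches P (t.bind f) := by
  induction h with
  | leaf i t => exact .leaf i _
  | node u c c' σ h ih => exact .node u c _ σ ih

theorem Contains.bind {S : Set (PTree ar)} {t : PTree ar} (h : Contains S t) (f : ℕ → PTree ar) :
    Contains S (t.bind f) := by
  induction h with
  | root P t hP h => exact .root P _ hP (h.bind f)
  | child u c j h ih => exact .child u _ j ih

theorem Contains.bind_of_mem {S : Set (PTree ar)} {t : PTree ar} {f : ℕ → PTree ar} {a : ℕ}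
    (ha : a ∈ t.labels) (h : Contains S (f a)) : Contains S (t.bind f) := by
  induction t with
  | leaf i =>
    simp only [labels, Multiset.mem_singleton] at ha
    exact ha ▸ h
  | node u c ih =>
    obtain ⟨j, hj⟩ := mem_labels_node.1 ha
    exact .child u _ j (ih j hj)

theorem sameSkeleton_relabel {P t : PTree ar} (h : P.SameSkeleton t) (φ : ℕ → ℕ) :
    P.SameSkeleton (t.relabel φ) := by
  induction h with
  | leaf i j => exact .leaf i _
  | node u c c' σ h ih => exact .node u c _ σ ih

/-- Number of internal vertices on a longest branch. -/
def height : PTree ar → ℕ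
  | leaf _ => 0
  | node _ c => (univ.sup fun j => (c j).height) + 1

theorem height_node_le {u : Υ} {c : Fin (ar u) → PTree ar} {D : ℕ} :
    (node u c).height ≤ D + 1 ↔ ∀ j, (c j).height ≤ D := by
  simp [height]

theorem SameSkeleton.height_le {v w : PTree ar} (h : v.SameSkeleton w) : w.height ≤ v.height := by
  induction h with
  | leaf i j => exact le_rfl
  | node u c c' σ h ih =>
    refine height_node_le.2 fun j => ?_
    have h1 := ih (σ.symm j)
    rw [σ.apply_symm_apply] at h1
    exact h1.trans (height_node_le.1 (le_refl (PTree.node u c).height) _)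

theorem pairwise_disjoint_forall {α β : Type*} {s : Multiset α} {f : α → Multiset β}
    (h : s.Pairwise (Function.onFun Disjoint f)) {a b : α} (ha : a ∈ s) (hb : b ∈ s)
    (hab : a ≠ b) : Disjoint (f a) (f b) := by
  have : Std.Symm (Function.onFun Disjoint f) := ⟨fun _ _ h => Disjoint.symm h⟩
  exact h.forall ha hb hab

theorem mem_labels_of_minLabel_eq (har : ∀ u, 0 < ar u) {t : PTree ar} {a : ℕ}
    (h : t.minLabel = a) : a ∈ t.labels :=
  h ▸ minLabel_mem har t

theorem Matches.refl (t : PTree ar) : Matches t t := by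
  induction t with
  | leaf i => exact .leaf i _
  | node u c ih => exact .node u c c 1 ih

theorem nodup_labels_node {u : Υ} {c : Fin (ar u) → PTree ar} (h : (node u c).labels.Nodup) :
    (∀ j, (c j).labels.Nodup) ∧
      ∀ i j a, a ∈ (c i).labels → a ∈ (c j).labels → i = j := by
  have h' : ((univ : Finset (Fin (ar u))).val.bind fun j => (c j).labels).Nodup := h
  rw [Multiset.nodup_bind] at h'
  refine ⟨fun j => h'.1 j (mem_univ j), fun i j a hi hj => ?_⟩
  by_contra hij
  exact Multiset.disjoint_left.1 (pairwise_disjoint_forall h'.2 (mem_univ i) (mem_univ j)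
    hij) hi hj

theorem Good.child {u : Υ} {c : Fin (ar u) → PTree ar} (h : (node u c).Good) (j : Fin (ar u)) :
    (c j).Good :=
  ⟨h.1.1 j, (nodup_labels_node h.2).1 j⟩

theorem labels_bind_le {t : PTree ar} {f g : ℕ → PTree ar}
    (h : ∀ a ∈ t.labels, (f a).labels ≤ (g a).labels) : (t.bind f).labels ≤ (t.bind g).labels := by
  induction t with
  | leaf i => exact h i (by simp [labels])
  | node u c ih =>
    exact Finset.sum_le_sum fun j _ => ih j fun a ha => h a (mem_labels_node.2 ⟨j, ha⟩)

/-- The planar labelled form of an occurrence at the root. -/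
theorem Matches.exists_bind (har : ∀ u, 0 < ar u) {P t : PTree ar} (h : Matches P t)
    (ht : t.labels.Nodup) :
    ∃ (P' : PTree ar) (f : ℕ → PTree ar), P.SameSkeleton P' ∧ t = P'.bind f ∧
      ∀ a ∈ P'.labels, (f a).minLabel = a := by
  induction h with
  | leaf i t =>
    -- The subtree hanging at a leaf of the pattern is recorded by its least label, so that cutting
    -- it off keeps the planar order.
    exact ⟨PTree.leaf t.minLabel, fun _ => t, .leaf _ _, rfl, by simp [labels]⟩
  | node u c c' σ h ih =>
    obtain ⟨hn, hd⟩ := nodup_labels_node ht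
    choose P' f h1 h2 h3 using fun j => ih j (hn (σ j))
    have hsub : ∀ j a, a ∈ (P' j).labels → a ∈ (c' (σ j)).labels := fun j a ha => by
      rw [h2 j, mem_labels_bind]
      exact ⟨a, ha, mem_labels_of_minLabel_eq har (h3 j a ha)⟩
    classical
    -- The graftings of the separate branches glue to one function, because different branches of a
    -- tree with distinct labels share no label.
    let F : ℕ → PTree ar := fun a =>
      if h : ∃ j, a ∈ (P' j).labels then f h.choose a else PTree.leaf a
    have hF : ∀ j a, a ∈ (P' j).labels → F a = f j a := fun j a ha => by
      have hex : ∃ j, a ∈ (P' j).labels := ⟨j, ha⟩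
      have : hex.choose = j := σ.injective (hd _ _ a (hsub _ _ hex.choose_spec) (hsub _ _ ha))
      simp only [F, dif_pos hex, this]
    refine ⟨PTree.node u fun j => P' (σ.symm j), F, .node u c _ σ fun j => ?_, ?_, ?_⟩
    · simpa using h1 j
    · simp only [PTree.bind]
      congr 1
      funext j
      have := h2 (σ.symm j)
      rw [σ.apply_symm_apply] at this
      rw [this]
      exact bind_congr fun a ha => (hF _ a ha).symm
    · intro a ha
      obtain ⟨j, hj⟩ := mem_labels_node.1 ha
      rw [hF _ a hj, h3 _ a hj]

theorem eq_of_mem_bind {P : PTree ar} {f : ℕ → PTree ar} (h : (P.bind f).labels.Nodup) {a b x : ℕ}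
    (ha : a ∈ P.labels) (hb : b ∈ P.labels) (hxa : x ∈ (f a).labels) (hxb : x ∈ (f b).labels) :
    a = b := by
  rw [labels_bind, Multiset.nodup_bind] at h
  by_contra hab
  exact Multiset.disjoint_left.1 (pairwise_disjoint_forall h.2 ha hb hab) hxa hxb

/-! ### Grafting in several places -/

/-- The tree `f a` for `a` in `F`, and a leaf otherwise. -/
def graftOn (f : ℕ → PTree ar) (F : Finset ℕ) (a : ℕ) : PTree ar := if a ∈ F then f a else leaf a

section

variable (har : ∀ u, 0 < ar u) {P : PTree ar} {f : ℕ → PTree ar}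
  (hf : ∀ a ∈ P.labels, (f a).minLabel = a) (hg : (P.bind f).Good)

include hf

theorem minLabel_graftOn (F : Finset ℕ) : ∀ a ∈ P.labels, (graftOn f F a).minLabel = a := by
  intro a ha
  rw [graftOn]
  split_ifs
  · exact hf a ha
  · exact minLabel_leaf a

include har hg

/-- A leaf `a` left in place has the same least label as `f a` and contributes fewer labels, so
every intermediate stage of the grafting inherits planarity and distinct labels from the final tree.
-/
theorem good_bind_graftOn (F : Finset ℕ) : (P.bind (graftOn f F)).Good := by
  obtain ⟨h1, h2⟩ := (ordered_bind_iff har (strictMonoOn_id) hf).1 hg.1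
  constructor
  · refine (ordered_bind_iff har strictMonoOn_id (minLabel_graftOn hf F)).2
      ⟨h1, fun a ha => ?_⟩
    rw [graftOn]
    split_ifs
    · exact h2 a ha
    · trivial
  · refine Multiset.nodup_of_le (labels_bind_le fun a ha => ?_) hg.2
    rw [graftOn]
    split_ifs
    · exact le_rfl
    · rw [labels, Multiset.singleton_le]
      exact mem_labels_of_minLabel_eq har (hf a ha)

theorem good_of_bind : P.Good := by
  have := good_bind_graftOn har hf hg ∅
  rwa [show graftOn f ∅ = leaf from funext fun a => by simp [graftOn], bind_leaf] at this

theorem good_of_mem {a : ℕ} (ha : a ∈ P.labels) : (f a).Good := by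
  refine ⟨((ordered_bind_iff har (strictMonoOn_id) hf).1 hg.1).2 a ha,
    Multiset.nodup_of_le ?_ hg.2⟩
  rw [labels_bind]
  exact Multiset.le_bind P.labels ha

theorem graft_graftOn {F : Finset ℕ} {i : ℕ} (hi : i ∈ P.labels) (hiF : i ∉ F) :
    graft i (P.bind (graftOn f F)) (f i) = P.bind (graftOn f (insert i F)) := by
  rw [graft, bind_bind]
  refine bind_congr fun a ha => ?_
  by_cases haF : a ∈ F
  · rw [graftOn, graftOn, if_pos haF, if_pos (mem_insert_of_mem haF)]
    conv_rhs => rw [← bind_leaf (f a)]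
    refine bind_congr fun b hb => if_neg ?_
    rintro rfl
    -- The label of the leaf still to be replaced already occurs in the tree to be inserted there,
    -- hence in none of the subtrees grafted before.
    have : b ∈ (f b).labels := mem_labels_of_minLabel_eq har (hf b hi)
    exact hiF (eq_of_mem_bind hg.2 ha hi hb this ▸ haF)
  · rw [graftOn, graftOn, if_neg haF]
    by_cases hai : a = i
    · simp [bind, hai]
    · simp [bind, hai, haF]

/-- Sets of shuffle monomials that are closed under shuffle compositions with monomials. -/
def _root_.ShuffleClosed (L : Set (PTree ar)) : Prop :=
  ∀ {m l i : ℕ} {φ ψ : ℕ → ℕ}, IsShuffle m l i φ ψ → ∀ v w : PTree ar, v.IsMon m → w.IsMon l →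
    v ∈ L ∨ w ∈ L → shuffleComp φ ψ i v w ∈ L

theorem std_graftOn_insert {L : Set (PTree ar)} (hL : ShuffleClosed L) {F : Finset ℕ} {i : ℕ}
    (hi : i ∈ P.labels) (hiF : i ∉ F)
    (h : std (P.bind (graftOn f F)) ∈ L ∨ std (f i) ∈ L) :
    std (P.bind (graftOn f (insert i F))) ∈ L := by
  rw [← graft_graftOn har hf hg hi hiF]
  have hv := good_bind_graftOn har hf hg F
  have hw := good_of_mem har hf hg hi
  obtain ⟨φ, ψ, j, hs, e⟩ := std_graft har hv hw (i := i)
    (mem_labels_bind.2 ⟨i, hi, by simp [graftOn, hiF, labels]⟩) (hf i hi) (by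
      intro a ha haw
      obtain ⟨b, hb, hab⟩ := mem_labels_bind.1 ha
      rw [graftOn] at hab
      split_ifs at hab with hbF
      · exact absurd (eq_of_mem_bind hg.2 hb hi hab haw ▸ hbF) hiF
      · simp only [labels, Multiset.mem_singleton] at hab
        subst hab
        exact eq_of_mem_bind hg.2 hb hi (mem_labels_of_minLabel_eq har (hf a hb)) haw)
  rw [e]
  exact hL hs _ _ (hv.isMon_std har) (hw.isMon_std har) h

theorem std_bind_mem {L : Set (PTree ar)} (hL : ShuffleClosed L)
    (h : std P ∈ L ∨ ∃ i ∈ P.labels, std (f i) ∈ L) : std (P.bind f) ∈ L := by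
  have hfull : P.bind f = P.bind (graftOn f P.labels.toFinset) :=
    bind_congr fun a ha => by simp [graftOn, ha]
  rw [hfull]
  rcases h with h | ⟨i, hi, h⟩
  · have : ∀ F : Finset ℕ, (∀ a ∈ F, a ∈ P.labels) → std (P.bind (graftOn f F)) ∈ L := by
      intro F
      induction F using Finset.induction_on with
      | empty =>
        intro _
        rwa [show graftOn f ∅ = leaf from funext fun a => by simp [graftOn], bind_leaf]
      | insert i F hiF ih =>
        intro hF
        exact std_graftOn_insert har hf hg hL (hF i (mem_insert_self i F)) hiF
          (Or.inl (ih fun a ha => hF a (mem_insert_of_mem ha)))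
    exact this _ fun a ha => by simpa using ha
  -- The subtree known to lie in `L` is grafted last, so that a single composition with it suffices.
  · rw [← insert_erase (show i ∈ P.labels.toFinset by simpa using hi)]
    exact std_graftOn_insert har hf hg hL hi (notMem_erase i _) (Or.inr h)

end

/-- A tree is the corolla of its root, with leaves numbered by the least labels of the branches,
onto which the branches are grafted. -/
theorem std_mem_of_child (har : ∀ u, 0 < ar u) {L : Set (PTree ar)} (hL : ShuffleClosed L) {u : Υ}
    {c : Fin (ar u) → PTree ar} (hg : (node u c).Good) (j : Fin (ar u)) (h : std (c j) ∈ L) :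
    std (node u c) ∈ L := by
  classical
  have hinj : Function.Injective fun j => (c j).minLabel := hg.1.2.injective
  let f : ℕ → PTree ar := fun a => if h : ∃ j, (c j).minLabel = a then c h.choose else leaf a
  have hfc : ∀ j, f (c j).minLabel = c j := fun j => by
    have hex : ∃ i, (c i).minLabel = (c j).minLabel := ⟨j, rfl⟩
    simp only [f, dif_pos hex]
    rw [hinj hex.choose_spec]
  have e : node u c = (node u fun j => leaf (c j).minLabel).bind f := by
    simp only [bind, hfc]
  rw [e] at hg ⊢
  refine std_bind_mem har (fun a ha => ?_) hg hL (Or.inr ⟨(c j).minLabel, ?_, ?_⟩)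
  · obtain ⟨i, hi⟩ := mem_labels_node.1 ha
    simp only [labels, Multiset.mem_singleton] at hi
    rw [hi, hfc]
  · exact mem_labels_node.2 ⟨j, by simp [labels]⟩
  · rwa [hfc]

/-- At an occurrence the tree is a planar form of the pattern with subtrees grafted on it. After
standardization this form is a shuffle monomial with the skeleton of an element of `S`, hence it
lies in `S` by regularity. Closure of `L` under composition carries membership through the grafting
and up to the root. -/
theorem Contains.std_mem (har : ∀ u, 0 < ar u) {L S : Set (PTree ar)} (hL : ShuffleClosed L)
    (hS : SymmetricRegular S) (hSL : S ⊆ L) {t : PTree ar} (h : Contains S t) (ht : t.Good) :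
    std t ∈ L := by
  induction h with
  | root P t hP h =>
    obtain ⟨P', f, h1, rfl, h3⟩ := h.exists_bind har ht.2
    have hP' := good_of_bind har h3 ht
    exact std_bind_mem har h3 ht hL (Or.inl (hSL (hS P hP _ _ (hP'.isMon_std har)
      (sameSkeleton_relabel h1 _))))
  | child u c j h ih => exact std_mem_of_child har hL ht j (ih (ht.child j))

end PTree

/-! ### Leading monomials of an ideal -/

open PTree

section

variable {k : Type*} [Field k] {Υ : Type*} {ar : Υ → ℕ}

theorem lmapDomain_mem_supported {α β : Type*} {s : Set α} {s' : Set β} {g : α → β}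
    (h : ∀ a ∈ s, g a ∈ s') {f : α →₀ k} (hf : f ∈ Finsupp.supported k k s) :
    Finsupp.lmapDomain k k g f ∈ Finsupp.supported k k s' := by
  refine Finsupp.supported_mono (s := g '' s) (by rintro _ ⟨a, ha, rfl⟩; exact h a ha) ?_
  rw [← Finsupp.lmapDomain_supported]
  exact Submodule.mem_map_of_mem hf

/-- The ideal spanned by the monomials in which the skeleton of an element of `S` occurs. -/
def containsIdeal (k : Type*) [Field k] (har : ∀ u, 0 < ar u) (S : Set (PTree ar)) :
    ShuffleIdeal k ar where
  carrier n := Finsupp.supported k k {t | t.IsMon n ∧ Contains S t}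
  le_free n := Finsupp.supported_mono fun _ h => h.1
  comp_left := by
    intro m l i φ ψ h f hf w hw
    refine lmapDomain_mem_supported (s := {t | t.IsMon m ∧ Contains S t}) (fun v hv => ?_) hf
    exact ⟨isMon_shuffleComp har h hv.1 hw, hv.2.bind _⟩
  comp_right := by
    intro m l i φ ψ h g hg v hv
    refine lmapDomain_mem_supported (s := {t | t.IsMon l ∧ Contains S t}) (fun w hw => ?_) hg
    exact ⟨isMon_shuffleComp har h hv hw.1,
      Contains.bind_of_mem (hv.mem_labels.2 h.lt) (by rw [if_pos rfl]; exact hw.2.bind _)⟩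

theorem mem_monomialIdealSpan {S : Set (PTree ar)} {n : ℕ} {f : PTree ar →₀ k} :
    f ∈ monomialIdealSpan k S n ↔ ∀ J : ShuffleIdeal k ar,
      (∀ m, ∀ v ∈ S, v.IsMon m → Finsupp.single v 1 ∈ J.carrier m) → f ∈ J.carrier n := by
  rw [monomialIdealSpan, Submodule.mem_sInf]
  constructor
  · exact fun h J hJ => h _ ⟨J, hJ, rfl⟩
  · rintro h _ ⟨J, hJ, rfl⟩
    exact h J hJ

theorem span_single_eq_supported (L : Set (PTree ar)) (n : ℕ) :
    Submodule.span k {f | ∃ v ∈ L, v.IsMon n ∧ f = Finsupp.single v 1} =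
      Finsupp.supported k k {v | v ∈ L ∧ v.IsMon n} := by
  rw [Finsupp.supported_eq_span_single]
  congr 1
  ext f
  simp only [Set.mem_ofPred_eq, Set.mem_image]
  constructor
  · rintro ⟨v, h1, h2, rfl⟩
    exact ⟨v, ⟨h1, h2⟩, rfl⟩
  · rintro ⟨v, ⟨h1, h2⟩, rfl⟩
    exact ⟨v, h1, h2, rfl⟩

theorem single_mem_supported_iff {α : Type*} {s : Set α} {a : α} :
    Finsupp.single a (1 : k) ∈ Finsupp.supported k k s ↔ a ∈ s := by
  simp [Finsupp.mem_supported, Finsupp.support_single]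

/-- By the Gröbner property, being a leading monomial means lying in the monomial ideal generated by
the leading monomials of `G`. That ideal is an intersection of ideals, hence is closed under
composition. -/
theorem shuffleClosed_leadingMonomials (har : ∀ u, 0 < ar u) {O : AdmissibleOrder ar} {I : ShuffleIdeal k ar}
    {G : Set (PTree ar →₀ k)} (hG : IsGroebnerBasis O I G) :
    ShuffleClosed (leadingMonomials O I.elements) := by
  intro m l i φ ψ h v w hv hw hvw
  have key : ∀ {n t}, t.IsMon n → (t ∈ leadingMonomials O I.elements ↔
      Finsupp.single t 1 ∈ monomialIdealSpan k (leadingMonomials O G) n) := by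
    intro n t ht
    rw [hG.2, span_single_eq_supported, single_mem_supported_iff]
    simp [ht]
  have hT := isMon_shuffleComp har h hv hw
  rw [key hT, mem_monomialIdealSpan]
  intro J hJ
  rcases hvw with hv' | hw'
  · have := J.comp_left h _ (mem_monomialIdealSpan.1 ((key hv).1 hv') J hJ) w hw
    rwa [Finsupp.lmapDomain_apply, Finsupp.mapDomain_single] at this
  · have := J.comp_right h _ (mem_monomialIdealSpan.1 ((key hw).1 hw') J hJ) v hv
    rwa [Finsupp.lmapDomain_apply, Finsupp.mapDomain_single] at this

theorem leadingMonomials_mono (O : AdmissibleOrder ar) {G G' : Set (PTree ar →₀ k)} (h : G ⊆ G') :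
    leadingMonomials O G ⊆ leadingMonomials O G' :=
  fun _ ⟨g, hg, h'⟩ => ⟨g, h hg, h'⟩

theorem finite_leadingMonomials (O : AdmissibleOrder ar) {G : Set (PTree ar →₀ k)}
    (h : G.Finite) : (leadingMonomials O G).Finite :=
  (h.biUnion fun g _ => g.support.finite_toSet).subset fun v ⟨g, hg, hv, _⟩ => by
    simpa using ⟨g, hg, by simpa using hv⟩

/-- The leading monomials are recognized by occurrences of skeletons of bounded height. -/
theorem exists_contains_iff (har : ∀ u, 0 < ar u) {O : AdmissibleOrder ar} {I : ShuffleIdeal k ar}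
    {G : Set (PTree ar →₀ k)} (hfin : G.Finite) (hG : IsGroebnerBasis O I G)
    (hreg : SymmetricRegular (leadingMonomials O G) ∨
      SymmetricRegular (leadingMonomials O I.elements)) :
    ∃ (S : Set (PTree ar)) (D : ℕ), (∀ P ∈ S, P.height ≤ D) ∧ ∀ n (t : PTree ar), t.IsMon n →
      (t ∈ leadingMonomials O I.elements ↔ Contains S t) := by
  set L := leadingMonomials O I.elements with hL
  have hGL : leadingMonomials O G ⊆ L := leadingMonomials_mono O hG.1
  have key : ∀ S : Set (PTree ar), SymmetricRegular S → leadingMonomials O G ⊆ S → S ⊆ L →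
      ∀ n (t : PTree ar), t.IsMon n → (t ∈ L ↔ Contains S t) := by
    intro S hS hGS hSL n t ht
    constructor
    · intro htL
      have h1 : Finsupp.single t 1 ∈ monomialIdealSpan k (leadingMonomials O G) n := by
        rw [hG.2]
        exact Submodule.subset_span ⟨t, htL, ht, rfl⟩
      -- The monomials with an occurrence span an ideal containing the generators, so the generated
      -- ideal lies inside it.
      have h2 := mem_monomialIdealSpan.1 h1 (containsIdeal k har S) fun m v hv hm =>
        single_mem_supported_iff.2 ⟨hm, .root v v (hGS hv) (.refl v)⟩
      exact (single_mem_supported_iff.1 h2).2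
    · intro h
      rw [← ht.std_eq]
      exact h.std_mem har (shuffleClosed_leadingMonomials har hG) hS hSL ht.good
  obtain ⟨D, hD⟩ : ∃ D, ∀ P ∈ leadingMonomials O G, P.height ≤ D := by
    obtain ⟨D, hD⟩ := ((finite_leadingMonomials O hfin).image height).bddAbove
    exact ⟨D, fun P hP => hD ⟨P, hP, rfl⟩⟩
  rcases hreg with hreg | hreg
  · exact ⟨_, D, hD, key _ hreg subset_rfl hGL⟩
  -- All leading monomials of `I` may have unbounded height. Truncating at the height `D` of the
  -- leading monomials of `G` keeps the generators, and keeps regularity because height depends only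
  -- on the skeleton.
  · exact ⟨{v | v ∈ L ∧ v.height ≤ D}, D, fun P hP => hP.2,
      key _ (fun v hv n w hw hvw => ⟨hreg v hv.1 n w hw hvw, hvw.height_le.trans hv.2⟩)
        (fun v hv => ⟨hGL hv, hD v hv⟩) fun v hv => hv.1⟩

end

end

noncomputable section

open Finset

/-! ### Finitely many classes of skeletons -/

/-- A set of trees, given by a predicate, that is closed under passage to subtrees, together with a
finite classification of trees such that the class of a tree with a given root, and whether it
satisfies the predicate, depend only on the unordered collection of classes of its branches. -/
structure SkeletonClasses {Υ : Type*} (ar : Υ → ℕ) where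
  Normal : PTree ar → Prop
  Class : Type*
  finite : Finite Class
  cls : PTree ar → Class
  normal_child : ∀ {u c}, Normal (.node u c) → ∀ j, Normal (c j)
  cls_congr : ∀ {u} {c c' : Fin (ar u) → PTree ar} (σ : Equiv.Perm (Fin (ar u))),
    (∀ j, cls (c j) = cls (c' (σ j))) → cls (.node u c) = cls (.node u c')
  normal_congr : ∀ {u} {c c' : Fin (ar u) → PTree ar} (σ : Equiv.Perm (Fin (ar u))),
    (∀ j, Normal (c' j)) → (∀ j, cls (c j) = cls (c' (σ j))) →
      Normal (.node u c) → Normal (.node u c')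
  cls_leaf : ∀ i j, cls (.leaf i) = cls (.leaf j)
  normal_leaf : ∀ i j, Normal (.leaf i) → Normal (.leaf j)
  cls_leaf_ne : ∀ i u c, cls (.leaf i) ≠ cls (.node u c)
  root_eq : ∀ {u c u' c'}, cls (.node u c) = cls (.node u' c') → u = u'

namespace PTree

universe v

variable {Υ : Type v} {ar : Υ → ℕ}

/-- Families up to permutation of the indices. -/
def permSetoid (n : ℕ) (α : Type*) : Setoid (Fin n → α) where
  r a b := ∃ σ : Equiv.Perm (Fin n), ∀ j, a j = b (σ j)
  iseqv :=
    { refl := fun _ => ⟨1, fun _ => rfl⟩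
      symm := fun ⟨σ, h⟩ => ⟨σ.symm, fun j => by rw [h, σ.apply_symm_apply]⟩
      trans := fun ⟨σ, h⟩ ⟨τ, h'⟩ => ⟨σ.trans τ, fun j => by rw [h, h']; rfl⟩ }

/-- Skeletons of trees, cut off at a given height. -/
def Truncation (ar : Υ → ℕ) : ℕ → Type v
  | 0 => PUnit
  | D + 1 => Option (Σ u, Quotient (permSetoid (ar u) (Truncation ar D)))

instance finite_truncation [Finite Υ] (D : ℕ) : Finite (Truncation ar D) := by
  induction D with
  | zero => exact inferInstanceAs (Finite PUnit)
  | succ D ih => exact inferInstanceAs (Finite (Option _))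

/-- The skeleton of a tree, cut off at a given height. -/
def truncate : (D : ℕ) → PTree ar → Truncation ar D
  | 0, _ => PUnit.unit
  | _ + 1, leaf _ => none
  | D + 1, node u c => some ⟨u, Quotient.mk _ fun j => truncate D (c j)⟩

theorem truncate_node_eq_iff {D : ℕ} {u : Υ} {c c' : Fin (ar u) → PTree ar} :
    truncate (D + 1) (node u c) = truncate (D + 1) (node u c') ↔
      ∃ σ : Equiv.Perm (Fin (ar u)), ∀ j, truncate D (c j) = truncate D (c' (σ j)) := by
  constructor
  · intro h
    exact Quotient.exact (eq_of_heq (Sigma.mk.inj (Option.some.inj h)).2)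
  · intro h
    exact congrArg (fun x => some (Sigma.mk u x)) (Quotient.sound h)

theorem truncate_leaf_ne {D i : ℕ} {u : Υ} {c : Fin (ar u) → PTree ar} :
    truncate (D + 1) (leaf i) ≠ truncate (D + 1) (node u c) := by
  simp only [truncate]
  exact (Option.some_ne_none _).symm

theorem truncate_root_eq {D : ℕ} {u u' : Υ} {c : Fin (ar u) → PTree ar}
    {c' : Fin (ar u') → PTree ar}
    (h : truncate (D + 1) (node u c) = truncate (D + 1) (node u' c')) : u = u' := by
  simp only [truncate] at h
  exact congrArg Sigma.fst (Option.some_inj.1 h)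

theorem truncate_eq_of_succ {D : ℕ} {t t' : PTree ar}
    (h : truncate (D + 1) t = truncate (D + 1) t') : truncate D t = truncate D t' := by
  induction D generalizing t t' with
  | zero => rfl
  | succ D ih =>
    cases t with
    | leaf i =>
      cases t' with
      | leaf j => rfl
      | node u c => exact absurd h truncate_leaf_ne
    | node u c =>
      cases t' with
      | leaf j => exact absurd h.symm truncate_leaf_ne
      | node u' c' =>
        obtain rfl := truncate_root_eq h
        obtain ⟨σ, hσ⟩ := truncate_node_eq_iff.1 h
        exact truncate_node_eq_iff.2 ⟨σ, fun j => ih (hσ j)⟩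

/-- A pattern of height at most `D` inspects only the top `D` levels of the tree. -/
theorem Matches.of_truncate_eq {D : ℕ} {P t t' : PTree ar} (h : Matches P t) (hP : P.height ≤ D)
    (ht : truncate D t = truncate D t') : Matches P t' := by
  induction h generalizing D t' with
  | leaf i t => exact .leaf i _
  | node u c c' σ h ih =>
    cases D with
    | zero => simp [height] at hP
    | succ D =>
      cases t' with
      | leaf j => exact absurd ht.symm truncate_leaf_ne
      | node u' d =>
        obtain rfl := truncate_root_eq ht
        obtain ⟨τ, hτ⟩ := truncate_node_eq_iff.1 ht
        exact .node u c d (σ.trans τ) fun j => ih j (height_node_le.1 hP j) (hτ (σ j))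

theorem contains_node_iff {S : Set (PTree ar)} {u : Υ} {c : Fin (ar u) → PTree ar} :
    Contains S (node u c) ↔ (∃ P ∈ S, Matches P (node u c)) ∨ ∃ j, Contains S (c j) := by
  constructor
  · intro h
    cases h with
    | root P _ hP h => exact Or.inl ⟨P, hP, h⟩
    | child _ _ j h => exact Or.inr ⟨j, h⟩
  · rintro (⟨P, hP, h⟩ | ⟨j, h⟩)
    · exact .root P _ hP h
    · exact .child u c j h

/-- The trees that avoid a set of skeletons of bounded height. -/
def avoiding [Finite Υ] (S : Set (PTree ar)) (D : ℕ) (hD : ∀ P ∈ S, P.height ≤ D) :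
    SkeletonClasses ar where
  Normal t := ¬ Contains S t
  -- Height `D` suffices to detect the patterns. The extra level ensures, even for `D = 0`, that the
  -- class separates leaves from nodes and determines the root.
  Class := Truncation ar (D + 1)
  finite := inferInstance
  cls := truncate (D + 1)
  normal_child h j hj := h (.child _ _ j hj)
  cls_congr σ h := truncate_node_eq_iff.2 ⟨σ, fun j => truncate_eq_of_succ (h j)⟩
  normal_congr {u c c'} σ hc h hn hn' := by
    rcases contains_node_iff.1 hn' with ⟨P, hP, hm⟩ | ⟨j, hj⟩
    · refine hn (.root P _ hP (hm.of_truncate_eq (hD P hP) ?_))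
      exact truncate_eq_of_succ
        (truncate_node_eq_iff.2 ⟨σ, fun j => truncate_eq_of_succ (h j)⟩).symm
    · exact hc j hj
  cls_leaf i j := rfl
  normal_leaf i j h h' := h (h'.bind fun _ => leaf i)
  cls_leaf_ne i u c := truncate_leaf_ne
  root_eq h := truncate_root_eq h

end PTree

end

noncomputable section

open Finset

/-! ### Shuffle products of power series -/

section ShuffleProd

variable {R : Type*} [CommRing R] [Algebra ℚ R]

theorem derivative_shuffleProd (f g : PowerSeries R) :
    PowerSeries.derivative R (shuffleProd f g) = PowerSeries.derivative R f * g := by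
  ext n
  rw [PowerSeries.coeff_derivative, shuffleProd, PowerSeries.coeff_mk, Nat.add_sub_cancel,
    Algebra.smul_def, mul_right_comm, mul_comm (algebraMap ℚ R _)]
  have : ((n : R) + 1) = algebraMap ℚ R ((n + 1 : ℕ) : ℚ) := by simp
  rw [mul_assoc, this, mul_comm, mul_assoc, mul_comm, mul_assoc, ← map_mul, mul_inv_cancel₀
    (by positivity), map_one, mul_one]

theorem constantCoeff_shuffleProd (f g : PowerSeries R) :
    PowerSeries.constantCoeff (shuffleProd f g) = 0 := by
  rw [← PowerSeries.coeff_zero_eq_constantCoeff_apply, shuffleProd, PowerSeries.coeff_mk]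
  simp

theorem powerSeries_ext_derivative {f g : PowerSeries R}
    (h : PowerSeries.derivative R f = PowerSeries.derivative R g)
    (h0 : PowerSeries.constantCoeff f = PowerSeries.constantCoeff g) : f = g := by
  ext n
  cases n with
  | zero => simpa using h0
  | succ n =>
    have h' := congrArg (PowerSeries.coeff n) h
    rw [PowerSeries.coeff_derivative, PowerSeries.coeff_derivative] at h'
    have hu : IsUnit ((n : R) + 1) := by
      have : ((n : R) + 1) = algebraMap ℚ R ((n + 1 : ℕ) : ℚ) := by simp
      rw [this]
      exact (IsUnit.mk0 _ (by positivity)).map _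
    exact hu.mul_left_injective h'

/-- The only case not true by definition is `C(f, 1) = f`, where the vanishing constant term is
needed since the left side is `f - f(0)`. -/
theorem shuffleProdList_cons {f : PowerSeries R} (hf : PowerSeries.constantCoeff f = 0)
    (l : List (PowerSeries R)) :
    shuffleProdList (f :: l) = shuffleProd f (shuffleProdList l) := by
  cases l with
  | nil =>
    refine powerSeries_ext_derivative ?_ ?_
    · rw [derivative_shuffleProd]
      simp [shuffleProdList]
    · rw [constantCoeff_shuffleProd]
      exact hf
  | cons g l => rfl

theorem derivation_prod {k A M ι : Type*} [CommRing k] [CommRing A] [Algebra k A] [AddCommGroup M]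
    [Module A M] [Module k M] [DecidableEq ι] (D : Derivation k A M) (s : Finset ι)
    (f : ι → A) : D (∏ i ∈ s, f i) = ∑ i ∈ s, (∏ j ∈ s.erase i, f j) • D (f i) := by
  induction s using Finset.induction_on with
  | empty => simp
  | insert a s ha ih =>
    rw [prod_insert ha, D.leibniz, ih, sum_insert ha, erase_insert ha, smul_sum, add_comm]
    congr 1
    refine sum_congr rfl fun i hi => ?_
    rw [erase_insert_of_ne (by rintro rfl; exact ha hi), prod_insert (fun h => ha (mem_of_mem_erase h)),
      mul_smul]

theorem prod_swap_succ {M : Type*} [CommMonoid M] {d : ℕ} (f : Fin (d + 1) → M) (p : Fin (d + 1)) :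
    ∏ x : Fin d, f (Equiv.swap 0 p x.succ) = ∏ j ∈ univ.erase p, f j := by
  refine prod_bij (fun x _ => Equiv.swap 0 p x.succ) (fun x _ => ?_) (fun x _ x' _ h => ?_)
    (fun j hj => ?_) fun _ _ => rfl
  · rw [mem_erase, ne_eq, Equiv.swap_apply_eq_iff, Equiv.swap_apply_right]
    exact ⟨Fin.succ_ne_zero x, mem_univ _⟩
  · exact Fin.succ_injective _ ((Equiv.swap 0 p).injective h)
  · have : Equiv.swap 0 p j ≠ 0 := by
      rw [ne_eq, Equiv.swap_apply_eq_iff, Equiv.swap_apply_left]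
      exact ne_of_mem_erase hj
    obtain ⟨x, hx⟩ := Fin.exists_succ_eq.2 this
    exact ⟨x, mem_univ _, by rw [hx, Equiv.swap_apply_self]⟩

/-- The product is the sum of the shuffle products in all orders. -/
theorem sum_perm_shuffleProdList {d : ℕ} (f : Fin d → PowerSeries R)
    (hf : ∀ i, PowerSeries.constantCoeff (f i) = 0) :
    ∑ σ : Equiv.Perm (Fin d), shuffleProdList (List.ofFn fun j => f (σ j)) = ∏ i, f i := by
  induction d with
  | zero => simp [shuffleProdList]
  | succ d ih =>
    refine powerSeries_ext_derivative ?_ ?_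
    -- Both sides are differentiated. Permutations are grouped by the index `p` placed first; the
    -- derivative of such a group is `(f p)'` times the sum over the orders of the remaining
    -- factors, which is the Leibniz term at `p` by induction.
    · rw [derivation_prod, map_sum, ← Equiv.sum_comp Equiv.Perm.decomposeFin.symm,
        Fintype.sum_prod_type]
      refine sum_congr rfl fun p _ => ?_
      have h1 := ih (fun x => f (Equiv.swap 0 p x.succ)) fun x => hf _
      rw [← prod_swap_succ f p, ← h1, smul_eq_mul, sum_mul]
      refine sum_congr rfl fun e _ => ?_
      rw [List.ofFn_succ, shuffleProdList_cons (hf _), derivative_shuffleProd, mul_comm]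
      simp only [Equiv.Perm.decomposeFin_symm_apply_zero, Equiv.Perm.decomposeFin_symm_apply_succ]
    · rw [map_sum, map_prod, prod_eq_zero (f := fun i => PowerSeries.constantCoeff (f i)) (mem_univ 0) (hf 0)]
      refine sum_eq_zero fun σ _ => ?_
      rw [List.ofFn_succ, shuffleProdList_cons (hf _), constantCoeff_shuffleProd]

/-- Each product is expanded over all orders of its factors. By symmetry of `q`, every permutation
can be absorbed in the summation over `s`, so the `d!` orders contribute equally. -/
theorem sum_smul_prod_eq {ι : Type*} [Fintype ι] {d : ℕ} {q : (Fin d → ι) → ℕ}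
    (hq : ∀ s (σ : Equiv.Perm (Fin d)), q (s ∘ σ) = q s) {y : ι → PowerSeries R}
    (hy : ∀ i, PowerSeries.constantCoeff (y i) = 0) :
    ∑ s, q s • ∏ j, y (s j) =
      (d.factorial : ℚ) • ∑ s, q s • shuffleProdList (List.ofFn fun j => y (s j)) := by
  classical
  have h1 : ∀ s : Fin d → ι, q s • ∏ j, y (s j) = ∑ σ : Equiv.Perm (Fin d),
      q (s ∘ σ) • shuffleProdList (List.ofFn fun j => y ((s ∘ σ) j)) := by
    intro s
    rw [← sum_perm_shuffleProdList (fun j => y (s j)) fun j => hy _, smul_sum]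
    exact sum_congr rfl fun σ _ => by rw [hq]; rfl
  simp_rw [h1]
  rw [sum_comm]
  have h2 : ∀ σ : Equiv.Perm (Fin d), ∑ s : Fin d → ι,
      q (s ∘ σ) • shuffleProdList (List.ofFn fun j => y ((s ∘ σ) j)) =
      ∑ s, q s • shuffleProdList (List.ofFn fun j => y (s j)) := fun σ =>
    Equiv.sum_comp (σ.symm.arrowCongr (Equiv.refl ι))
      (fun s => q s • shuffleProdList (List.ofFn fun j => y (s j)))
  simp_rw [h2]
  rw [sum_const, card_univ, Fintype.card_perm, Fintype.card_fin, ← Nat.cast_smul_eq_nsmul ℚ]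

end ShuffleProd

/-! ### Polynomial systems with invertible Jacobian matrix -/

section DiffMatrix

variable {N : ℕ} {d : Fin N → ℕ}

/-- The matrix of divided differences of the polynomials `τ j * ∑ s, q j s • ∏ l, y (s l)`. -/
def diffMatrix {S : Type*} [CommRing S] (q : ∀ j, (Fin (d j) → Fin (N + 1)) → ℕ) (τ : Fin N → S)
    (y y' : Fin (N + 1) → S) : Matrix (Fin N) (Fin N) S := fun j i =>
  τ j * ∑ s, q j s • ∑ l, if s l = i.succ then
    (∏ l' with l' < l, y' (s l')) * ∏ l' with l < l', y (s l') else 0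

theorem map_diffMatrix {S S' : Type*} [CommRing S] [CommRing S'] (φ : S →+* S')
    (q : ∀ j, (Fin (d j) → Fin (N + 1)) → ℕ) (τ : Fin N → S) (y y' : Fin (N + 1) → S) :
    (diffMatrix q τ y y').map φ =
      diffMatrix q (fun j => φ (τ j)) (fun j => φ (y j)) fun j => φ (y' j) := by
  ext j i
  simp only [diffMatrix, Matrix.map_apply, map_mul, map_sum, map_nsmul, apply_ite φ, map_prod,
    map_zero]

theorem map_det_one_sub_diffMatrix {S S' : Type*} [CommRing S] [CommRing S'] (φ : S →+* S')
    (q : ∀ j, (Fin (d j) → Fin (N + 1)) → ℕ) (τ : Fin N → S) (y y' : Fin (N + 1) → S) :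
    φ (1 - diffMatrix q τ y y').det =
      (1 - diffMatrix q (fun j => φ (τ j)) (fun j => φ (y j)) fun j => φ (y' j)).det := by
  rw [← map_diffMatrix, RingHom.map_det, map_sub, map_one]
  rfl

/-- Cramer's rule: multiply the relations by the adjugate matrix. This needs no division, so the
unknowns may lie in any module. -/
theorem det_smul_eq_zero {S M n : Type*} [CommRing S] [AddCommGroup M] [Module S M] [Fintype n]
    [DecidableEq n] {A : Matrix n n S} {v : n → M} (h : ∀ j, ∑ k, A j k • v k = 0) (i : n) :
    A.det • v i = 0 := by
  have h1 : ∑ j, A.adjugate i j • ∑ k, A j k • v k = 0 := by simp [h]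
  simp_rw [smul_sum, smul_smul] at h1
  rw [sum_comm] at h1
  simp_rw [← sum_smul] at h1
  have h2 : ∀ k, ∑ j, A.adjugate i j * A j k = if i = k then A.det else 0 := by
    intro k
    have := congrFun (congrFun (Matrix.adjugate_mul A) i) k
    rw [Matrix.mul_apply] at this
    rw [this]
    simp [Matrix.one_apply]
  simpa [h2] using h1

theorem sum_succ_eq {M ι : Type*} [AddCommMonoid M] [Fintype ι] (s : ι → Fin (N + 1))
    (w : ι → Fin (N + 1) → M) (h0 : ∀ l, w l 0 = 0) :
    ∑ l, w l (s l) = ∑ i : Fin N, ∑ l, if s l = i.succ then w l i.succ else 0 := by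
  rw [sum_comm]
  refine sum_congr rfl fun l _ => ?_
  obtain h | ⟨i, h⟩ := Fin.eq_zero_or_eq_succ (s l)
  · rw [h, h0]
    simp [(Fin.succ_ne_zero _).symm]
  · rw [h]
    simp

/-- A difference of products telescopes by exchanging one factor at a time. The column of the
unknown with index `0` is absent because `y` and `y'` agree there. -/
theorem sub_eq_diffMatrix {S : Type*} [CommRing S] (q : ∀ j, (Fin (d j) → Fin (N + 1)) → ℕ)
    (τ : Fin N → S) {y y' : Fin (N + 1) → S} (h0 : y 0 = y' 0) (j : Fin N) :
    τ j * (∑ s, q j s • ∏ l, y (s l)) - τ j * (∑ s, q j s • ∏ l, y' (s l)) =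
      ∑ i, diffMatrix q τ y y' j i * (y i.succ - y' i.succ) := by
  have h1 : ∀ s : Fin (d j) → Fin (N + 1), ∏ l, y (s l) - ∏ l, y' (s l) =
      ∑ i : Fin N, (∑ l, if s l = i.succ then
        (∏ l' with l' < l, y' (s l')) * ∏ l' with l < l', y (s l') else 0) *
          (y i.succ - y' i.succ) := by
    intro s
    have := prod_sub_ordered univ (fun l => y (s l)) fun l => y (s l) - y' (s l)
    simp only [sub_sub_cancel] at this
    rw [this, sub_sub_cancel]
    have h2 := sum_succ_eq s (fun l i => (y i - y' i) *
      (∏ l' with l' < l, y' (s l')) * ∏ l' with l < l', y (s l')) (by simp [h0])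
    rw [h2]
    refine sum_congr rfl fun i _ => ?_
    rw [sum_mul]
    refine sum_congr rfl fun l _ => ?_
    split_ifs
    · ring
    · simp
  rw [← mul_sub, ← sum_sub_distrib]
  simp_rw [← smul_sub, h1, diffMatrix, mul_assoc, ← mul_sum, smul_sum]
  rw [sum_comm]
  congr 1
  refine sum_congr rfl fun i _ => ?_
  rw [sum_mul]
  exact sum_congr rfl fun s _ => by rw [← smul_sum, smul_mul_assoc]

theorem prod_erase_eq {S ι : Type*} [CommRing S] [Fintype ι] [LinearOrder ι] (f : ι → S) (l : ι) :
    ∏ l' ∈ univ.erase l, f l' = (∏ l' with l' < l, f l') * ∏ l' with l < l', f l' := by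
  rw [← prod_union (disjoint_filter.2 fun x _ h h' => lt_asymm h h')]
  congr 1
  ext x
  simp [lt_or_lt_iff_ne]

/-- On the diagonal `y = y'` the divided differences become partial derivatives, so this is the
chain rule with the Jacobian matrix. -/
theorem derivation_eq_diffMatrix {k S M : Type*} [CommRing k] [CommRing S] [Algebra k S]
    [AddCommGroup M] [Module S M] [Module k M] (D : Derivation k S M)
    (q : ∀ j, (Fin (d j) → Fin (N + 1)) → ℕ) {τ : Fin N → S} {y : Fin (N + 1) → S}
    (h0 : D (y 0) = 0) (hτ : ∀ j, D (τ j) = 0) (j : Fin N) :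
    D (τ j * ∑ s, q j s • ∏ l, y (s l)) =
      ∑ i, diffMatrix q τ y y j i • D (y i.succ) := by
  have h1 : ∀ s : Fin (d j) → Fin (N + 1), D (∏ l, y (s l)) =
      ∑ i : Fin N, (∑ l, if s l = i.succ then
        (∏ l' with l' < l, y (s l')) * ∏ l' with l < l', y (s l') else 0) • D (y i.succ) := by
    intro s
    rw [derivation_prod]
    simp_rw [prod_erase_eq]
    have h2 := sum_succ_eq s (fun l i => ((∏ l' with l' < l, y (s l')) *
      ∏ l' with l < l', y (s l')) • D (y i)) (by simp [h0])
    rw [h2]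
    refine sum_congr rfl fun i _ => ?_
    rw [sum_smul]
    exact sum_congr rfl fun l _ => by rw [ite_smul, zero_smul]
  rw [D.leibniz, hτ, smul_zero, add_zero, map_sum]
  simp_rw [map_nsmul, h1, diffMatrix, mul_smul, ← smul_sum]
  congr 1
  simp_rw [sum_smul, smul_sum]
  rw [sum_comm]
  refine sum_congr rfl fun i _ => sum_congr rfl fun s _ => ?_
  rw [← smul_sum, ← sum_smul, ← smul_sum, smul_assoc]

/-! ### Algebraicity from vanishing differentials. -/

theorem subsingleton_kaehlerDifferential_of_adjoin {F K : Type*} [Field F] [Field K] [Algebra F K]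
    {s : Set K} (h : ∀ x (hx : x ∈ s), KaehlerDifferential.D F (IntermediateField.adjoin F s)
      ⟨x, IntermediateField.subset_adjoin F s hx⟩ = 0) :
    Subsingleton (KaehlerDifferential F (IntermediateField.adjoin F s)) := by
  let L := IntermediateField.adjoin F s
  let D := KaehlerDifferential.D F L
  have hD : ∀ x : L, D x = 0 := by
    rintro ⟨x, hx⟩
    induction hx using IntermediateField.adjoin_induction with
    | mem x hx => exact h x hx
    | algebraMap x => exact D.map_algebraMap x
    | add x y hx hy h1 h2 =>
      have : (⟨x + y, add_mem hx hy⟩ : L) = ⟨x, hx⟩ + ⟨y, hy⟩ := rfl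
      rw [this, map_add, h1, h2, add_zero]
    | inv x hx h1 =>
      have : (⟨x⁻¹, inv_mem hx⟩ : L) = (⟨x, hx⟩ : L)⁻¹ := rfl
      rw [this, D.leibniz_inv, h1, smul_zero]
    | mul x y hx hy h1 h2 =>
      have : (⟨x * y, mul_mem hx hy⟩ : L) = ⟨x, hx⟩ * ⟨y, hy⟩ := rfl
      rw [this, D.leibniz, h1, h2, smul_zero, smul_zero, add_zero]
  have hbot : (⊤ : Submodule L (KaehlerDifferential F L)) = ⊥ := by
    rw [← KaehlerDifferential.span_range_derivation, Submodule.span_eq_bot]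
    rintro _ ⟨x, rfl⟩
    exact hD x
  exact (Submodule.subsingleton_iff L).1 (subsingleton_of_bot_eq_top hbot.symm)

/-- Differentiating the equations over `F` shows that the Jacobian determinant kills every `dy j`;
being nonzero, it forces all of them to vanish. The field generated by the `y j` thus has no
differentials over `F`, and a finitely generated extension with this property is separable
algebraic. -/
theorem isAlgebraic_of_system_field {F K : Type*} [Field F] [Field K] [Algebra F K]
    (q : ∀ j, (Fin (d j) → Fin (N + 1)) → ℕ) (a0 : F) (aτ : Fin N → F)
    {y : Fin (N + 1) → K} (h0 : y 0 = algebraMap F K a0)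
    (hy : ∀ j : Fin N, y j.succ = algebraMap F K (aτ j) * ∑ s, q j s • ∏ l, y (s l))
    (hdet : (1 - diffMatrix q (fun j => algebraMap F K (aτ j)) y y).det ≠ 0) (j : Fin (N + 1)) :
    IsAlgebraic F (y j) := by
  let L := IntermediateField.adjoin F (Set.range y)
  let yL : Fin (N + 1) → L := fun j => ⟨y j, IntermediateField.subset_adjoin _ _ ⟨j, rfl⟩⟩
  let τL : Fin N → L := fun j => algebraMap F L (aτ j)
  have hinj : Function.Injective (algebraMap L K) := (algebraMap L K).injective
  have hyL : ∀ j : Fin N, yL j.succ = τL j * ∑ s, q j s • ∏ l, yL (s l) := by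
    intro j
    apply hinj
    simp only [map_mul, map_sum, map_nsmul, map_prod]
    exact hy j
  have hdetL : (1 - diffMatrix q τL yL yL).det ≠ 0 := by
    intro h
    have h1 := congrArg (algebraMap L K) h
    rw [map_det_one_sub_diffMatrix, map_zero] at h1
    exact hdet h1
  have hyL0 : yL 0 = algebraMap F L a0 := hinj h0
  have : Algebra.EssFiniteType F L :=
    IntermediateField.essFiniteType_iff.2 (IntermediateField.fg_adjoin_of_finite (Set.finite_range _))
  let D := KaehlerDifferential.D F L
  have hD0 : D (yL 0) = 0 := by rw [hyL0]; exact D.map_algebraMap _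
  have hDτ : ∀ j, D (τL j) = 0 := fun j => D.map_algebraMap _
  have h1 : ∀ i, (1 - diffMatrix q τL yL yL).det • D (yL (Fin.succ i)) = 0 := by
    refine det_smul_eq_zero (v := fun i => D (yL (Fin.succ i))) fun j => ?_
    simp only [Matrix.sub_apply, sub_smul, sum_sub_distrib]
    rw [← derivation_eq_diffMatrix D q hD0 hDτ, ← hyL]
    simp [Matrix.one_apply]
  have hDy : ∀ j, D (yL j) = 0 := by
    intro j
    obtain rfl | ⟨i, rfl⟩ := Fin.eq_zero_or_eq_succ j
    · exact hD0
    · exact (smul_eq_zero.1 (h1 i)).resolve_left hdetL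
  have : Algebra.FormallyUnramified F L := by
    refine ⟨subsingleton_kaehlerDifferential_of_adjoin ?_⟩
    rintro _ ⟨j, rfl⟩
    exact hDy j
  have hsep : Algebra.IsSeparable F L := (Algebra.FormallyUnramified.iff_isSeparable F L).1 this
  have h2 : IsAlgebraic F (yL j) := (Algebra.IsSeparable.isAlgebraic F L).isAlgebraic _
  exact h2.algebraMap (A := K)

/-- Solutions of a polynomial system at which the Jacobian determinant does not vanish are
algebraic over the ring of coefficients. -/
theorem isAlgebraic_of_system {A S : Type*} [CommRing A] [IsDomain A] [CommRing S] [IsDomain S]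
    [Algebra A S] [FaithfulSMul A S] (q : ∀ j, (Fin (d j) → Fin (N + 1)) → ℕ) {τ : Fin N → S}
    {y : Fin (N + 1) → S} (h0 : ∃ a, algebraMap A S a = y 0) (hτ : ∀ j, ∃ a, algebraMap A S a = τ j)
    (hy : ∀ j : Fin N, y j.succ = τ j * ∑ s, q j s • ∏ l, y (s l))
    (hdet : (1 - diffMatrix q τ y y).det ≠ 0) (j : Fin (N + 1)) : IsAlgebraic A (y j) := by
  let K := FractionRing S
  let F := FractionRing A
  -- Injectivity of `A → K` makes the fraction field of `A` act on that of `S`, which reduces the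
  -- claim to the case of fields.
  have : FaithfulSMul A K := by
    rw [faithfulSMul_iff_algebraMap_injective, IsScalarTower.algebraMap_eq A S K]
    exact (IsFractionRing.injective S K).comp (FaithfulSMul.algebraMap_injective A S)
  let : Algebra F K := FractionRing.liftAlgebra A K
  have : IsScalarTower A F K := FractionRing.isScalarTower_liftAlgebra A K
  choose a0 h0 using h0
  choose aτ hτ using hτ
  have hK : ∀ a, algebraMap F K (algebraMap A F a) = algebraMap S K (algebraMap A S a) := fun a => by
    rw [← IsScalarTower.algebraMap_apply A F K, ← IsScalarTower.algebraMap_apply A S K]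
  have h2 : IsAlgebraic F (algebraMap S K (y j)) := by
    refine isAlgebraic_of_system_field q (algebraMap A F a0) (fun j => algebraMap A F (aτ j))
      (y := fun j => algebraMap S K (y j)) ?_ (fun j => ?_) ?_ j
    · rw [hK, h0]
    · rw [hK, hτ, hy]
      simp only [map_mul, map_sum, map_nsmul, map_prod]
    · simp only [hK, hτ]
      rw [← map_det_one_sub_diffMatrix]
      exact fun h => hdet (IsFractionRing.injective S K (h.trans (map_zero _).symm))
  rw [← IsFractionRing.isAlgebraic_iff A F K] at h2
  exact (isAlgebraic_algebraMap_iff (IsFractionRing.injective S K)).1 h2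

end DiffMatrix

end

noncomputable section

open Finset

/-! ### Solutions of the systems -/

section Systems

variable {R : Type*} [CommRing R] [Algebra ℚ R] {Υ : Type*} {ar : Υ → ℕ} {N : ℕ}

/-- The coefficient `t ^ a / d!` of an equation of the algebraic system. -/
def systemCoeff (S : Type*) [CommRing S] [Algebra ℚ S] (ar : Υ → ℕ) (t : S) (deg : Υ → ℕ)
    (root : Fin N → Υ) (j : Fin N) : S :=
  t ^ deg (root j) * algebraMap ℚ S ((ar (root j)).factorial : ℚ)⁻¹

theorem map_systemCoeff {S S' : Type*} [CommRing S] [Algebra ℚ S] [CommRing S'] [Algebra ℚ S']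
    (φ : S →+* S') (t : S) (deg : Υ → ℕ) (root : Fin N → Υ) (j : Fin N) :
    φ (systemCoeff S ar t deg root j) = systemCoeff S' ar (φ t) deg root j := by
  rw [systemCoeff, systemCoeff, map_mul, map_pow, RingHom.map_rat_algebraMap]

variable {t : R} {deg : Υ → ℕ} {root : Fin N → Υ}
  {q : ∀ j, (Fin (ar (root j)) → Fin (N + 1)) → ℕ} {y y' : Fin (N + 1) → PowerSeries R}

theorem solvesAlgebraicSystem_iff : SolvesAlgebraicSystem ar t deg root q y ↔
    y 0 = PowerSeries.X ∧ (∀ i, PowerSeries.constantCoeff (y i) = 0) ∧ ∀ j : Fin N,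
      y j.succ = systemCoeff _ ar (PowerSeries.C t) deg root j *
        ∑ s, q j s • ∏ l, y (s l) := by
  simp only [SolvesAlgebraicSystem, systemCoeff, Algebra.smul_def, map_pow, mul_assoc]

theorem SolvesAlgebraicSystem.map {R' : Type*} [CommRing R'] [Algebra ℚ R'] (φ : R →+* R')
    (h : SolvesAlgebraicSystem ar t deg root q y) :
    SolvesAlgebraicSystem ar (φ t) deg root q fun j => PowerSeries.map φ (y j) := by
  rw [solvesAlgebraicSystem_iff] at h ⊢
  obtain ⟨h1, h2, h3⟩ := h
  refine ⟨by rw [h1, PowerSeries.map_X], fun i => ?_, fun j => ?_⟩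
  · rw [← PowerSeries.coeff_zero_eq_constantCoeff_apply, PowerSeries.coeff_map,
      PowerSeries.coeff_zero_eq_constantCoeff_apply, h2, map_zero]
  · rw [h3]
    simp only [map_mul, map_sum, map_nsmul, map_prod]
    rw [map_systemCoeff, PowerSeries.map_C]

/-- With symmetric coefficients the factor `d!` from `sum_smul_prod_eq` cancels the `1 / d!` of the
algebraic equations, so the systems coincide on series without constant term. -/
theorem solvesIntegralSystem_iff (hq : ∀ j s (σ : Equiv.Perm (Fin (ar (root j)))),
    q j (s ∘ σ) = q j s) :
    SolvesIntegralSystem ar t deg root q y ↔ SolvesAlgebraicSystem ar t deg root q y := by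
  refine and_congr_right fun _ => and_congr_right fun h0 => forall_congr' fun j => ?_
  rw [sum_smul_prod_eq (hq j) h0, smul_smul, inv_mul_cancel₀ (by positivity), one_smul]

/-- Invertibility of a power series is decided at `z = 0`, where all the unknowns vanish. -/
theorem isUnit_det_one_sub_diffMatrix
    (hdet : IsUnit (1 - diffMatrix q (systemCoeff R ar t deg root) 0 0).det)
    (hy : ∀ i, PowerSeries.constantCoeff (y i) = 0)
    (hy' : ∀ i, PowerSeries.constantCoeff (y' i) = 0) :
    IsUnit (1 - diffMatrix q (systemCoeff _ ar (PowerSeries.C t) deg root) y y').det := by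
  rw [PowerSeries.isUnit_iff_constantCoeff, map_det_one_sub_diffMatrix]
  simp only [map_systemCoeff, PowerSeries.constantCoeff_C, hy, hy']
  exact hdet

/-- Uniqueness, if the linear part of the system is invertible. -/
theorem SolvesAlgebraicSystem.unique
    (hdet : IsUnit (1 - diffMatrix q (systemCoeff R ar t deg root) 0 0).det)
    (h : SolvesAlgebraicSystem ar t deg root q y) (h' : SolvesAlgebraicSystem ar t deg root q y') :
    y' = y := by
  rw [solvesAlgebraicSystem_iff] at h h'
  have hu := isUnit_det_one_sub_diffMatrix hdet h'.2.1 h.2.1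
  -- Subtracting the equations gives a homogeneous linear system for the difference of the
  -- solutions, with the matrix of divided differences.
  have h1 : ∀ i : Fin N, (1 - diffMatrix q (systemCoeff _ ar (PowerSeries.C t) deg root) y' y).det •
      (y' i.succ - y i.succ) = 0 := by
    refine det_smul_eq_zero (v := fun i : Fin N => y' i.succ - y i.succ) fun j => ?_
    simp only [Matrix.sub_apply, smul_eq_mul, sub_mul, sum_sub_distrib]
    rw [← sub_eq_diffMatrix q _ (h'.1.trans h.1.symm), ← h.2.2, ← h'.2.2]
    simp [Matrix.one_apply]
  funext j
  obtain rfl | ⟨i, rfl⟩ := Fin.eq_zero_or_eq_succ j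
  · exact h'.1.trans h.1.symm
  · exact sub_eq_zero.1 ((hu.smul_eq_zero).1 (h1 i))

theorem extendZero_id : extendZero (id : Fin N → Fin N) = id := by
  funext j
  obtain rfl | ⟨i, rfl⟩ := Fin.eq_zero_or_eq_succ j <;> rfl

/-- Symmetric coefficients reduce to themselves: the shuffle products then add up to ordinary
products, so no unknowns have to be merged. -/
theorem coefficientsReduce_id (hq : ∀ j s (σ : Equiv.Perm (Fin (ar (root j)))),
    q j (s ∘ σ) = q j s) : CoefficientsReduce ar root id q q := by
  refine ⟨hq, fun j s => ?_⟩
  refine Eq.trans ?_ (Fintype.sum_eq_single (α := {i : Fin N // id i = j}) ⟨j, rfl⟩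
    fun x hx => absurd (Subtype.ext x.2) hx).symm
  rw [extendZero_id]
  rfl

theorem solutionsReduce_id (hq : ∀ j s (σ : Equiv.Perm (Fin (ar (root j)))), q j (s ∘ σ) = q j s)
    (hdet : IsUnit (1 - diffMatrix q (systemCoeff R ar t deg root) 0 0).det)
    (h : SolvesAlgebraicSystem ar t deg root q y) :
    SolutionsReduce ar t deg root id q q y y := by
  refine ⟨(solvesIntegralSystem_iff hq).2 h,
    fun x' hx' => h.unique hdet ((solvesIntegralSystem_iff hq).1 hx'), h,
    fun y' hy' => h.unique hdet hy', fun j => ?_⟩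
  rw [extendZero_id, sum_filter]
  simp

theorem SolvesAlgebraicSystem.isAlgebraic {A : Type*} [CommRing A] [IsDomain A] [IsDomain R]
    [Algebra A (PowerSeries R)] [FaithfulSMul A (PowerSeries R)]
    (hdet : IsUnit (1 - diffMatrix q (systemCoeff R ar t deg root) 0 0).det)
    (h : SolvesAlgebraicSystem ar t deg root q y)
    (hX : PowerSeries.X ∈ (algebraMap A (PowerSeries R)).range)
    (ht : PowerSeries.C t ∈ (algebraMap A (PowerSeries R)).range)
    (hQ : ∀ c : ℚ, algebraMap ℚ (PowerSeries R) c ∈ (algebraMap A (PowerSeries R)).range)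
    (j : Fin (N + 1)) : IsAlgebraic A (y j) := by
  rw [solvesAlgebraicSystem_iff] at h
  refine isAlgebraic_of_system (d := fun j => ar (root j)) q (by rw [h.1]; exact hX) (fun j => ?_)
    h.2.2 (isUnit_det_one_sub_diffMatrix hdet h.2.1 h.2.1).ne_zero j
  exact Subring.mul_mem _ (Subring.pow_mem _ ht _) (hQ _)

end Systems

end

noncomputable section

open Finset

/-! ### Counting by degree -/

/-- The series `F` counts the elements of a type by their degrees. -/
def HasSeries {α : Type*} (d : α → ℕ) (F : PowerSeries ℚ) : Prop :=
  ∀ e, Finite {a // d a = e} ∧ (Nat.card {a // d a = e} : ℚ) = PowerSeries.coeff e F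

namespace HasSeries

variable {α β : Type*} {d : α → ℕ} {d' : β → ℕ} {F G : PowerSeries ℚ}

theorem unique (h : HasSeries d F) (h' : HasSeries d G) : F = G := by
  ext e
  rw [← (h e).2, (h' e).2]

theorem of_equiv (h : HasSeries d F) (f : β ≃ α) (hf : ∀ b, d' b = d (f b)) :
    HasSeries d' F := by
  intro e
  have g : {b // d' b = e} ≃ {a // d a = e} := f.subtypeEquiv fun b => by rw [hf]
  have := (h e).1
  exact ⟨Finite.of_equiv _ g.symm, by rw [Nat.card_congr g, (h e).2]⟩

theorem of_finite (h : ∀ e, Finite {a // d a = e}) :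
    HasSeries d (PowerSeries.mk fun e => (Nat.card {a // d a = e} : ℚ)) :=
  fun e => ⟨h e, by rw [PowerSeries.coeff_mk]⟩

theorem of_isEmpty [IsEmpty α] (d : α → ℕ) : HasSeries d 0 :=
  fun e => ⟨inferInstance, by simp⟩

theorem of_unique [Unique α] (hd : d default = 0) : HasSeries d 1 := by
  intro e
  refine ⟨inferInstance, ?_⟩
  rw [PowerSeries.coeff_one]
  split_ifs with he
  · subst he
    have : Unique {a // d a = 0} := ⟨⟨⟨default, hd⟩⟩, fun a => Subtype.ext (Unique.eq_default _)⟩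
    simp
  · have : IsEmpty {a // d a = e} := ⟨fun a => he (by rw [← a.2, Unique.eq_default a.1, hd])⟩
    simp

theorem prod (h : HasSeries d F) (h' : HasSeries d' G) :
    HasSeries (fun p : α × β => d p.1 + d' p.2) (F * G) := by
  intro e
  let g : {p : α × β // d p.1 + d' p.2 = e} ≃
      Σ x : antidiagonal e, {a // d a = x.1.1} × {b // d' b = x.1.2} :=
    { toFun := fun p => ⟨⟨(d p.1.1, d' p.1.2), mem_antidiagonal.2 p.2⟩, ⟨p.1.1, rfl⟩, ⟨p.1.2, rfl⟩⟩
      invFun := fun x => ⟨(x.2.1.1, x.2.2.1), by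
        rw [x.2.1.2, x.2.2.2]
        exact mem_antidiagonal.1 x.1.2⟩
      left_inv := fun p => rfl
      right_inv := by
        rintro ⟨⟨⟨i, j⟩, hx⟩, ⟨a, ha⟩, ⟨b, hb⟩⟩
        dsimp only at ha hb
        subst ha hb
        rfl }
  have := fun e => (h e).1
  have := fun e => (h' e).1
  refine ⟨Finite.of_equiv _ g.symm, ?_⟩
  rw [Nat.card_congr g, Nat.card_sigma, PowerSeries.coeff_mul, Nat.cast_sum]
  refine Eq.trans ?_ (sum_coe_sort (antidiagonal e)
    fun p => PowerSeries.coeff p.1 F * PowerSeries.coeff p.2 G)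
  exact sum_congr rfl fun x _ => by rw [Nat.card_prod, Nat.cast_mul, (h _).2, (h' _).2]

theorem sum_fiber {ι : Type*} (f : α → ι) (s : Finset ι) (hf : ∀ a, f a ∈ s)
    {F : ι → PowerSeries ℚ} (h : ∀ w ∈ s, HasSeries (fun a : {a // f a = w} => d a) (F w)) :
    HasSeries d (∑ w ∈ s, F w) := by
  intro e
  let g : {a // d a = e} ≃ Σ w : s, {a : {a // f a = w.1} // d a = e} :=
    { toFun := fun a => ⟨⟨f a, hf a⟩, ⟨a, rfl⟩, a.2⟩
      invFun := fun x => ⟨x.2.1.1, x.2.2⟩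
      left_inv := fun p => rfl
      right_inv := by
        rintro ⟨⟨w, hw⟩, ⟨⟨a, rfl : f a = w⟩, ha⟩⟩
        rfl }
  have : ∀ w : s, Finite {a : {a // f a = w.1} // d a = e} := fun w => (h w.1 w.2 e).1
  refine ⟨Finite.of_equiv _ g.symm, ?_⟩
  rw [Nat.card_congr g, Nat.card_sigma, map_sum, Nat.cast_sum]
  refine Eq.trans ?_ (sum_coe_sort s fun w => PowerSeries.coeff e (F w))
  exact sum_congr rfl fun w _ => (h w.1 w.2 e).2

theorem add_const (h : HasSeries d F) (k : ℕ) :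
    HasSeries (fun a => k + d a) (PowerSeries.X ^ k * F) := by
  intro e
  rw [PowerSeries.coeff_X_pow_mul']
  split_ifs with hk
  · have g : {a // k + d a = e} ≃ {a // d a = e - k} :=
      (Equiv.refl α).subtypeEquiv fun a => by simp only [Equiv.refl_apply]; omega
    have := (h (e - k)).1
    exact ⟨Finite.of_equiv _ g.symm, by rw [Nat.card_congr g, (h _).2]⟩
  · have : IsEmpty {a // k + d a = e} := ⟨fun a => hk (by have := a.2; omega)⟩
    exact ⟨inferInstance, by simp⟩

end HasSeries

/-- This is the labelled counting rule for `C(f, g)`. From a set with `#V + 1` elements the least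
one is put into the first block; `W` is the rest of that block and the second block is the
complement of `W` in `V`. -/
theorem sum_powerset_coeff_shuffleProd {R : Type*} [CommRing R] [Algebra ℚ R]
    (f g : PowerSeries R) (V : Finset ℕ) :
    ∑ W ∈ V.powerset, (((#W + 1).factorial : ℚ) • PowerSeries.coeff (#W + 1) f) *
      (((#V - #W).factorial : ℚ) • PowerSeries.coeff (#V - #W) g) =
    ((#V + 1).factorial : ℚ) • PowerSeries.coeff (#V + 1) (shuffleProd f g) := by
  rw [sum_powerset_apply_card (fun i => (((i + 1).factorial : ℚ) • PowerSeries.coeff (i + 1) f) *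
      (((#V - i).factorial : ℚ) • PowerSeries.coeff (#V - i) g)), shuffleProd, PowerSeries.coeff_mk,
    Nat.add_sub_cancel, smul_smul, PowerSeries.coeff_mul, Finset.Nat.sum_antidiagonal_eq_sum_range_succ
      (fun i j => PowerSeries.coeff i (PowerSeries.derivative R f) * PowerSeries.coeff j g), smul_sum]
  refine sum_congr rfl fun i hi => ?_
  have hi' : i ≤ #V := Nat.lt_succ_iff.1 (mem_range.1 hi)
  rw [PowerSeries.coeff_derivative, smul_mul_smul_comm, ← Nat.cast_smul_eq_nsmul ℚ, smul_smul]
  have : PowerSeries.coeff (i + 1) f * ((i : R) + 1) =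
      ((i + 1 : ℕ) : ℚ) • PowerSeries.coeff (i + 1) f := by
    rw [Algebra.smul_def, mul_comm]
    simp
  rw [this, smul_mul_assoc, smul_smul]
  congr 1
  have h1 := Nat.choose_mul_factorial_mul_factorial hi'
  rw [Nat.factorial_succ, Nat.factorial_succ, ← h1]
  push_cast
  field_simp

end

/-! ### Numbered classes of normal trees and the coefficients of the system. -/

noncomputable section

open Finset PTree

variable {Υ : Type*} {ar : Υ → ℕ}

/-- Representatives of the classes of normal trees; number `0` is the leaf. -/
structure ClassList (𝒞 : SkeletonClasses ar) (N : ℕ) where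
  root : Fin N → Υ
  rep : Fin (N + 1) → PTree ar
  rep_zero : rep 0 = .leaf 0
  rep_succ : ∀ j, ∃ c, rep j.succ = .node (root j) c
  good : ∀ j, (rep j).Good
  normal : ∀ j : Fin N, 𝒞.Normal (rep j.succ)
  exists_cls : ∀ t, t.Good → 𝒞.Normal t → ∃ j, 𝒞.cls t = 𝒞.cls (rep j)
  cls_injective : Function.Injective fun j => 𝒞.cls (rep j)

theorem exists_classList (𝒞 : SkeletonClasses ar) : ∃ N, Nonempty (ClassList 𝒞 N) := by
  classical
  have := 𝒞.finite
  -- Only classes realized by normal trees that are not leaves are numbered here. The leaf receives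
  -- the number `0` in any case, even if it is not normal.
  let B := {q : 𝒞.Class // ∃ u c, (node u c).Good ∧ 𝒞.Normal (node u c) ∧ 𝒞.cls (node u c) = q}
  let e : B ≃ Fin (Nat.card B) := Finite.equivFin B
  choose u c hg hn hc using fun j => (e.symm j).2
  refine ⟨Nat.card B, ⟨u, Fin.cons (leaf 0) fun j => node (u j) (c j), rfl, fun j => ⟨c j, rfl⟩,
    ?_, hn, ?_, ?_⟩⟩
  · intro j
    obtain rfl | ⟨j, rfl⟩ := Fin.eq_zero_or_eq_succ j
    · exact ⟨trivial, by simp [labels]⟩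
    · exact hg j
  · intro t ht hnt
    cases t with
    | leaf i => exact ⟨0, 𝒞.cls_leaf _ _⟩
    | node v d =>
      refine ⟨(e ⟨𝒞.cls (node v d), v, d, ht, hnt, rfl⟩).succ, ?_⟩
      rw [Fin.cons_succ, hc, e.symm_apply_apply]
  · intro i j hij
    obtain rfl | ⟨i, rfl⟩ := Fin.eq_zero_or_eq_succ i <;>
    obtain rfl | ⟨j, rfl⟩ := Fin.eq_zero_or_eq_succ j
    · rfl
    · exact absurd hij (𝒞.cls_leaf_ne _ _ _)
    · exact absurd hij.symm (𝒞.cls_leaf_ne _ _ _)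
    · simp only [Fin.cons_succ, hc] at hij
      rw [e.symm.injective (Subtype.ext hij)]

namespace SkeletonClasses

variable (𝒞 : SkeletonClasses ar)

theorem relabel_iff (φ : ℕ → ℕ) (t : PTree ar) :
    (𝒞.Normal (t.relabel φ) ↔ 𝒞.Normal t) ∧ 𝒞.cls (t.relabel φ) = 𝒞.cls t := by
  induction t with
  | leaf i => exact ⟨⟨𝒞.normal_leaf _ _, 𝒞.normal_leaf _ _⟩, 𝒞.cls_leaf _ _⟩
  | node u c ih =>
    have hc : ∀ j, 𝒞.cls ((c j).relabel φ) = 𝒞.cls (c ((1 : Equiv.Perm (Fin (ar u))) j)) :=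
      fun j => (ih j).2
    refine ⟨⟨fun h => ?_, fun h => ?_⟩, 𝒞.cls_congr 1 hc⟩
    · exact 𝒞.normal_congr 1 (fun j => (ih j).1.1 (𝒞.normal_child h j)) hc h
    · exact 𝒞.normal_congr 1 (fun j => (ih j).1.2 (𝒞.normal_child h j)) (fun j => (hc j).symm) h

theorem exists_normal_leaf (har : ∀ u, 0 < ar u) {t : PTree ar} (h : 𝒞.Normal t) :
    𝒞.Normal (leaf 0) := by
  induction t with
  | leaf i => exact 𝒞.normal_leaf _ _ h
  | node u c ih => exact ih ⟨0, har u⟩ (𝒞.normal_child h _)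

end SkeletonClasses

namespace ClassList

variable {𝒞 : SkeletonClasses ar} {N : ℕ} (ℓ : ClassList 𝒞 N)

/-- A normal tree of a given class. -/
def Has (j : Fin (N + 1)) (t : PTree ar) : Prop := 𝒞.Normal t ∧ 𝒞.cls t = 𝒞.cls (ℓ.rep j)

theorem Has.eq {ℓ : ClassList 𝒞 N} {i j : Fin (N + 1)} {t : PTree ar} (h : ℓ.Has i t)
    (h' : ℓ.Has j t) : i = j :=
  ℓ.cls_injective (h.2.symm.trans h'.2)

theorem has_relabel_iff {j : Fin (N + 1)} {t : PTree ar} (φ : ℕ → ℕ) :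
    ℓ.Has j (t.relabel φ) ↔ ℓ.Has j t := by
  rw [Has, Has, (𝒞.relabel_iff φ t).1, (𝒞.relabel_iff φ t).2]

theorem exists_has {t : PTree ar} (ht : t.Good) (hn : 𝒞.Normal t) : ∃ j, ℓ.Has j t := by
  obtain ⟨j, hj⟩ := ℓ.exists_cls t ht hn
  exact ⟨j, hn, hj⟩

theorem Has.exists_leaf {ℓ : ClassList 𝒞 N} {t : PTree ar} (h : ℓ.Has 0 t) :
    ∃ i, t = leaf i := by
  cases t with
  | leaf i => exact ⟨i, rfl⟩
  | node u c =>
    have := h.2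
    rw [ℓ.rep_zero] at this
    exact absurd this.symm (𝒞.cls_leaf_ne _ _ _)

theorem Has.exists_node {ℓ : ClassList 𝒞 N} {t : PTree ar} {j : Fin N} (h : ℓ.Has j.succ t) :
    ∃ c, t = node (ℓ.root j) c := by
  obtain ⟨d, hd⟩ := ℓ.rep_succ j
  have := h.2
  rw [hd] at this
  cases t with
  | leaf i => exact absurd this (𝒞.cls_leaf_ne _ _ _)
  | node u c =>
    obtain rfl := 𝒞.root_eq this
    exact ⟨c, rfl⟩

/-- The leaf chosen for the class `0` need not be normal in general; it is as soon as some normal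
tree belongs to this class. -/
theorem Has.normal_rep {ℓ : ClassList 𝒞 N} {t : PTree ar} {j : Fin (N + 1)} (h : ℓ.Has j t) :
    𝒞.Normal (ℓ.rep j) := by
  obtain rfl | ⟨j, rfl⟩ := Fin.eq_zero_or_eq_succ j
  · obtain ⟨i, rfl⟩ := h.exists_leaf
    rw [ℓ.rep_zero]
    exact 𝒞.normal_leaf _ _ h.1
  · exact ℓ.normal j

open Classical in
/-- The coefficients of the system of equations. -/
def coeff (j : Fin N) (s : Fin (ar (ℓ.root j)) → Fin (N + 1)) : ℕ :=
  if ℓ.Has j.succ (node (ℓ.root j) fun l => ℓ.rep (s l)) then 1 else 0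

theorem coeff_eq_one_iff {j : Fin N} {s : Fin (ar (ℓ.root j)) → Fin (N + 1)} :
    ℓ.coeff j s = 1 ↔ ℓ.Has j.succ (node (ℓ.root j) fun l => ℓ.rep (s l)) := by
  simp [coeff]

theorem coeff_eq_zero_or_one (j : Fin N) (s : Fin (ar (ℓ.root j)) → Fin (N + 1)) :
    ℓ.coeff j s = 0 ∨ ℓ.coeff j s = 1 := by
  rw [coeff]
  split_ifs <;> simp

theorem has_node_congr {j : Fin (N + 1)} {u : Υ} {c c' : Fin (ar u) → PTree ar}
    (σ : Equiv.Perm (Fin (ar u))) (hc : ∀ l, 𝒞.Normal (c' l))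
    (h : ∀ l, 𝒞.cls (c l) = 𝒞.cls (c' (σ l))) (hn : ℓ.Has j (node u c)) :
    ℓ.Has j (node u c') :=
  ⟨𝒞.normal_congr σ hc h hn.1, (𝒞.cls_congr σ h).symm.trans hn.2⟩

/-- Branches can be exchanged for the representatives of their classes, so a single coefficient
decides for all tuples of branches of given classes. -/
theorem has_node_iff {j : Fin N} {s : Fin (ar (ℓ.root j)) → Fin (N + 1)}
    {c : Fin (ar (ℓ.root j)) → PTree ar} (h : ∀ l, ℓ.Has (s l) (c l)) :
    ℓ.Has j.succ (node (ℓ.root j) c) ↔ ℓ.coeff j s = 1 := by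
  rw [coeff_eq_one_iff]
  exact ⟨ℓ.has_node_congr 1 (fun l => (h l).normal_rep) fun l => (h l).2,
    ℓ.has_node_congr 1 (fun l => (h l).1) fun l => (h l).2.symm⟩

/-- Class and normality do not see the order of the branches. They are defined on all trees, so the
permuted tuple of representatives need not be planar or have distinct labels. -/
theorem coeff_symm (j : Fin N) (s : Fin (ar (ℓ.root j)) → Fin (N + 1))
    (σ : Equiv.Perm (Fin (ar (ℓ.root j)))) : ℓ.coeff j (s ∘ σ) = ℓ.coeff j s := by
  have : ℓ.Has j.succ (node (ℓ.root j) fun l => ℓ.rep ((s ∘ σ) l)) ↔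
      ℓ.Has j.succ (node (ℓ.root j) fun l => ℓ.rep (s l)) := by
    constructor
    · intro h
      refine ℓ.has_node_congr σ (fun l => ?_) (fun l => rfl) h
      have := 𝒞.normal_child h.1 (σ.symm l)
      simpa using this
    · intro h
      exact ℓ.has_node_congr σ.symm (fun l => 𝒞.normal_child h.1 (σ l)) (fun l => by simp) h
  classical exact if_congr this rfl rfl

/-! ### Counting trees -/

/-- The trees of a given class with a given set of labels. -/
abbrev Trees (j : Fin (N + 1)) (V : Finset ℕ) : Type _ :=
  {t : PTree ar // t.labels = V.val ∧ t.Ordered ∧ ℓ.Has j t}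

/-- The tuples of trees of given classes with a given total set of labels, in the order of their
smallest labels. -/
abbrev Forests {d : ℕ} (s : Fin d → Fin (N + 1)) (V : Finset ℕ) : Type _ :=
  {c : Fin d → PTree ar // ∑ l, (c l).labels = V.val ∧ (∀ l, (c l).Ordered ∧ ℓ.Has (s l) (c l)) ∧
    StrictMono fun l => (c l).minLabel}

theorem ordered_relabel_rankIn (har : ∀ u, 0 < ar u) {V : Finset ℕ} {t : PTree ar}
    (h : t.labels = V.val) : (t.relabel (rankIn V)).Ordered ↔ t.Ordered :=
  ordered_relabel_iff har ((rankIn_strictMonoOn V).mono fun a ha => by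
    simpa [h] using ha)

theorem ordered_relabel_unrankIn (har : ∀ u, 0 < ar u) {V : Finset ℕ} {t : PTree ar}
    (h : t.labels = (range #V).val) : (t.relabel (unrankIn V)).Ordered ↔ t.Ordered :=
  ordered_relabel_iff har ((unrankIn_strictMonoOn V).mono fun a ha => by
    simpa [h] using ha)

/-- Renumbering of the leaves by an initial segment. -/
def treesEquiv (har : ∀ u, 0 < ar u) (j : Fin (N + 1)) (V : Finset ℕ) :
    ℓ.Trees j V ≃ ℓ.Trees j (range #V) where
  toFun t := ⟨t.1.relabel (rankIn V), by
    rw [labels_relabel, t.2.1, ← image_rankIn, image_val_of_injOn (rankIn_strictMonoOn V).injOn],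
    (ordered_relabel_rankIn har t.2.1).2 t.2.2.1, (ℓ.has_relabel_iff _).2 t.2.2.2⟩
  invFun t := ⟨t.1.relabel (unrankIn V), by
    have h := image_unrankIn_coe V
    rw [← coe_range, ← coe_image, coe_inj] at h
    conv_rhs => rw [← h]
    rw [labels_relabel, t.2.1, image_val_of_injOn]
    rw [coe_range]
    exact (unrankIn_strictMonoOn V).injOn,
    (ordered_relabel_unrankIn har t.2.1).2 t.2.2.1, (ℓ.has_relabel_iff _).2 t.2.2.2⟩
  left_inv t := Subtype.ext (by
    refine (relabel_relabel _ _ _).trans ?_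
    exact relabel_eq_self fun a ha => unrankIn_rankIn (by rw [t.2.1] at ha; exact ha))
  right_inv t := Subtype.ext (by
    refine (relabel_relabel _ _ _).trans ?_
    exact relabel_eq_self fun a ha => rankIn_unrankIn (by
      rw [t.2.1] at ha
      exact mem_range.1 ha))

theorem isEmpty_trees_empty (har : ∀ u, 0 < ar u) (j : Fin (N + 1)) : IsEmpty (ℓ.Trees j ∅) :=
  ⟨fun t => by
    obtain ⟨a, ha⟩ := exists_mem_labels har t.1
    rw [t.2.1] at ha
    simp at ha⟩

/-- The exponential generating series of the trees of a given class. -/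
def series (deg : Υ → ℕ) (j : Fin (N + 1)) : PowerSeries (PowerSeries ℚ) :=
  PowerSeries.mk fun n => ((n.factorial : ℚ)⁻¹) • PowerSeries.mk fun e =>
    (Nat.card {t : ℓ.Trees j (range n) // t.1.degree deg = e} : ℚ)

section Series

variable (har : ∀ u, 0 < ar u) {deg : Υ → ℕ}
  (hfin : ∀ j n e, Finite {t : ℓ.Trees j (range n) // t.1.degree deg = e})

theorem factorial_smul_coeff_series (j : Fin (N + 1)) (n : ℕ) :
    (n.factorial : ℚ) • PowerSeries.coeff n (ℓ.series deg j) = PowerSeries.mk fun e =>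
      (Nat.card {t : ℓ.Trees j (range n) // t.1.degree deg = e} : ℚ) := by
  rw [series, PowerSeries.coeff_mk, smul_smul, mul_inv_cancel₀ (by positivity), one_smul]

include hfin in
theorem hasSeries_trees_range (j : Fin (N + 1)) (n : ℕ) :
    HasSeries (fun t : ℓ.Trees j (range n) => t.1.degree deg)
      ((n.factorial : ℚ) • PowerSeries.coeff n (ℓ.series deg j)) := by
  rw [factorial_smul_coeff_series]
  exact HasSeries.of_finite (hfin j n)

include har hfin in
theorem hasSeries_trees (j : Fin (N + 1)) (V : Finset ℕ) :
    HasSeries (fun t : ℓ.Trees j V => t.1.degree deg)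
      (((#V).factorial : ℚ) • PowerSeries.coeff #V (ℓ.series deg j)) :=
  (ℓ.hasSeries_trees_range hfin j #V).of_equiv (ℓ.treesEquiv har j V)
    fun t => (degree_relabel deg _ t.1).symm

include har in
theorem constantCoeff_series (j : Fin (N + 1)) :
    PowerSeries.constantCoeff (ℓ.series deg j) = 0 := by
  have := ℓ.isEmpty_trees_empty har j
  rw [← PowerSeries.coeff_zero_eq_constantCoeff_apply, series, PowerSeries.coeff_mk]
  ext e
  have : IsEmpty {t : ℓ.Trees j (range 0) // t.1.degree deg = e} := by
    rw [range_zero]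
    infer_instance
  simp

end Series

end ClassList

end

/-! ### Recursive count of forests and the integral system. -/

noncomputable section

open Finset PTree

variable {Υ : Type*} {ar : Υ → ℕ}

namespace ClassList

variable {𝒞 : SkeletonClasses ar} {N : ℕ} (ℓ : ClassList 𝒞 N)

theorem sum_labels_cons {d : ℕ} (t : PTree ar) (c : Fin d → PTree ar) :
    ∑ l, (Fin.cons (α := fun _ => PTree ar) t c l).labels = t.labels + ∑ l, (c l).labels := by
  rw [Fin.sum_univ_succ]
  simp

/-- The first tree of a nonempty forest has the smallest label. -/
theorem labels_forest_zero (har : ∀ u, 0 < ar u) {d : ℕ} {s : Fin (d + 1) → Fin (N + 1)}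
    {V : Finset ℕ} {a : ℕ} (ha : a ∈ V) (hmin : ∀ b ∈ V, a ≤ b) (c : ℓ.Forests s V) :
    (c.1 0).labels = (insert a ((c.1 0).labels.toFinset.erase a)).val ∧
      (c.1 0).labels.toFinset.erase a ⊆ V.erase a := by
  obtain ⟨c, h1, h2, h3⟩ := c
  have hmem : ∀ l b, b ∈ (c l).labels → b ∈ V := fun l b hb => by
    rw [← Finset.mem_val, ← h1, Multiset.mem_sum]
    exact ⟨l, mem_univ l, hb⟩
  have ha0 : a ∈ (c 0).labels := by
    rw [← Finset.mem_val, ← h1, Multiset.mem_sum] at ha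
    obtain ⟨l, -, hl⟩ := ha
    by_cases hl0 : l = 0
    · exact hl0 ▸ hl
    · have h4 : (c 0).minLabel < (c l).minLabel := h3 (Fin.pos_of_ne_zero hl0)
      have h5 := hmin _ (hmem 0 _ (minLabel_mem har (c 0)))
      have h6 := minLabel_le hl
      omega
  have hnd : (c 0).labels.Nodup := by
    refine Multiset.nodup_of_le ?_ V.nodup
    rw [← h1, Fin.sum_univ_succ]
    exact Multiset.le_add_right _ _
  refine ⟨?_, erase_subset_erase a fun b hb => hmem 0 b (by simpa using hb)⟩
  rw [insert_erase (by simpa using ha0), Multiset.toFinset_val, hnd.dedup]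

/-- Removal of the first tree of a forest with a given set of labels. -/
def forestsFiberEquiv (har : ∀ u, 0 < ar u) {d : ℕ} (s : Fin (d + 1) → Fin (N + 1))
    {V : Finset ℕ} {a : ℕ} (ha : a ∈ V) (hmin : ∀ b ∈ V, a ≤ b) {W : Finset ℕ}
    (hW : W ⊆ V.erase a) :
    {c : ℓ.Forests s V // (c.1 0).labels.toFinset.erase a = W} ≃
      ℓ.Trees (s 0) (insert a W) × ℓ.Forests (fun l => s l.succ) (V \ insert a W) where
  toFun c := (⟨c.1.1 0, by
      have := (ℓ.labels_forest_zero har ha hmin c.1).1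
      rwa [c.2] at this, c.1.2.2.1 0⟩,
    ⟨fun l => c.1.1 l.succ, by
      have h := (ℓ.labels_forest_zero har ha hmin c.1).1
      rw [c.2] at h
      have h1 := c.1.2.1
      rw [Fin.sum_univ_succ, h] at h1
      rw [sdiff_val]
      exact (tsub_eq_of_eq_add_rev h1.symm).symm,
      fun l => c.1.2.2.1 l.succ, c.1.2.2.2.comp (Fin.strictMono_succ)⟩)
  invFun p := ⟨⟨Fin.cons p.1.1 p.2.1, by
      rw [sum_labels_cons, p.1.2.1, p.2.2.1, sdiff_val]
      exact add_tsub_cancel_of_le (val_le_iff.2 (insert_subset ha (hW.trans (erase_subset _ _)))),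
      Fin.cases p.1.2.2 p.2.2.2.1, by
      -- The tree put in front owns the least label `a`, and all others have larger labels; this
      -- restores the order of the least labels.
      have h0 : p.1.1.minLabel = a :=
        minLabel_eq (by rw [p.1.2.1]; exact mem_insert_self a W) fun b hb => by
          rw [p.1.2.1] at hb
          exact hmin b (insert_subset ha (hW.trans (erase_subset _ _)) hb)
      have h1 : ∀ l, a < (p.2.1 l).minLabel := fun l => by
        have h2 : (p.2.1 l).minLabel ∈ ∑ l, (p.2.1 l).labels :=
          Multiset.mem_sum.2 ⟨l, mem_univ l, minLabel_mem har _⟩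
        rw [p.2.2.1, Finset.mem_val, mem_sdiff, mem_insert, not_or] at h2
        exact lt_of_le_of_ne (hmin _ h2.1) (Ne.symm h2.2.1)
      intro i j hij
      obtain rfl | ⟨i, rfl⟩ := Fin.eq_zero_or_eq_succ i <;>
      obtain rfl | ⟨j, rfl⟩ := Fin.eq_zero_or_eq_succ j
      · exact absurd hij (lt_irrefl _)
      · simpa [h0] using h1 j
      · exact absurd hij (Fin.not_lt_zero _)
      · simpa using p.2.2.2.2 (Fin.succ_lt_succ_iff.1 hij)⟩, by
      simp only [Fin.cons_zero]
      rw [p.1.2.1, val_toFinset, erase_insert fun h => (mem_erase.1 (hW h)).1 rfl]⟩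
  left_inv c := by
    apply Subtype.ext
    apply Subtype.ext
    funext l
    obtain rfl | ⟨l, rfl⟩ := Fin.eq_zero_or_eq_succ l <;> rfl
  right_inv p := rfl

section Series

variable (har : ∀ u, 0 < ar u) {deg : Υ → ℕ}
  (hfin : ∀ j n e, Finite {t : ℓ.Trees j (range n) // t.1.degree deg = e})

include har hfin

/-- The least label `a` of `V` always lies in the first tree. Once the other labels `W` of that tree
are chosen, the tree and the remaining forest are independent, and summing over `W` is the counting
rule for `C(f, g)`. -/
theorem hasSeries_forests {d : ℕ} (s : Fin d → Fin (N + 1)) (V : Finset ℕ) :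
    HasSeries (fun c : ℓ.Forests s V => ∑ l, (c.1 l).degree deg)
      (((#V).factorial : ℚ) • PowerSeries.coeff #V
        (shuffleProdList (List.ofFn fun l => ℓ.series deg (s l)))) := by
  classical
  induction d generalizing V with
  | zero =>
    -- The empty forest exists only over the empty set of labels; this matches the convention that
    -- the empty operation `C` is `1`.
    simp only [List.ofFn_zero, shuffleProdList, PowerSeries.coeff_one]
    by_cases hV : V = ∅
    · subst hV
      have : Unique (ℓ.Forests s ∅) :=
        { default := ⟨Fin.elim0, by simp, fun l => l.elim0, fun l => l.elim0⟩
          uniq := fun c => Subtype.ext (funext fun l => l.elim0) }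
      simpa using HasSeries.of_unique (d := fun c : ℓ.Forests s ∅ => ∑ l, (c.1 l).degree deg)
        (by simp)
    · have : IsEmpty (ℓ.Forests s V) := ⟨fun c => hV (by
        have := c.2.1
        simpa [eq_comm] using this)⟩
      rw [if_neg (by simpa using hV), smul_zero]
      exact HasSeries.of_isEmpty _
  | succ d ih =>
    rw [List.ofFn_succ, shuffleProdList_cons (ℓ.constantCoeff_series har _)]
    obtain rfl | hne := V.eq_empty_or_nonempty
    · have : IsEmpty (ℓ.Forests s ∅) := ⟨fun c => by
        obtain ⟨a, ha⟩ := exists_mem_labels har (c.1 0)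
        have : a ∈ ∑ l, (c.1 l).labels := Multiset.mem_sum.2 ⟨0, mem_univ 0, ha⟩
        rw [c.2.1] at this
        simp at this⟩
      rw [card_empty, PowerSeries.coeff_zero_eq_constantCoeff_apply, constantCoeff_shuffleProd,
        smul_zero]
      exact HasSeries.of_isEmpty _
    · set a := V.min' hne with ha'
      have ha : a ∈ V := V.min'_mem hne
      have hmin : ∀ b ∈ V, a ≤ b := fun b hb => V.min'_le b hb
      have hcard : #(V.erase a) + 1 = #V := card_erase_add_one ha
      have key := HasSeries.sum_fiber (d := fun c : ℓ.Forests s V => ∑ l, (c.1 l).degree deg)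
        (fun c => (c.1 0).labels.toFinset.erase a) (V.erase a).powerset
        (fun c => mem_powerset.2 (ℓ.labels_forest_zero har ha hmin c).2)
        (F := fun W => (((#W + 1).factorial : ℚ) • PowerSeries.coeff (#W + 1)
          (ℓ.series deg (s 0))) * (((#(V.erase a) - #W).factorial : ℚ) •
            PowerSeries.coeff (#(V.erase a) - #W)
              (shuffleProdList (List.ofFn fun l => ℓ.series deg (s (Fin.succ l)))))) ?_
      · rwa [sum_powerset_coeff_shuffleProd, hcard] at key
      · intro W hW
        rw [mem_powerset] at hW
        have haW : a ∉ W := fun h => (mem_erase.1 (hW h)).1 rfl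
        have h1 := ℓ.hasSeries_trees har hfin (s 0) (insert a W)
        have h2 := ih (fun l => s l.succ) (V \ insert a W)
        rw [card_insert_of_notMem haW] at h1
        rw [card_sdiff_of_subset (insert_subset ha (hW.trans (erase_subset _ _))),
          card_insert_of_notMem haW, ← hcard, Nat.add_sub_add_right] at h2
        refine (h1.prod h2).of_equiv (ℓ.forestsFiberEquiv har s ha hmin hW) fun c => ?_
        exact Fin.sum_univ_succ _

omit har hfin

/-- The number of the class of a tree. -/
def index (t : PTree ar) : Fin (N + 1) :=
  open Classical in if h : ∃ j, ℓ.Has j t then h.choose else 0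

theorem has_iff_index {t : PTree ar} (ht : t.Good) (hn : 𝒞.Normal t) {j : Fin (N + 1)} :
    ℓ.Has j t ↔ ℓ.index t = j := by
  have hex := ℓ.exists_has ht hn
  have : ℓ.Has (ℓ.index t) t := by
    rw [index, dif_pos hex]
    exact hex.choose_spec
  exact ⟨fun h => this.eq h, fun h => h ▸ this⟩

/-- The tuples of branches of the trees of a given class. -/
abbrev Branches (j : Fin N) (V : Finset ℕ) : Type _ :=
  {c : Fin (ar (ℓ.root j)) → PTree ar // (node (ℓ.root j) c).labels = V.val ∧
    (node (ℓ.root j) c).Ordered ∧ ℓ.Has j.succ (node (ℓ.root j) c)}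

/-- A tree is determined by its root and its branches. -/
def treesSuccEquiv (j : Fin N) (V : Finset ℕ) : ℓ.Trees j.succ V ≃ ℓ.Branches j V :=
  (Equiv.ofBijective (fun c : ℓ.Branches j V => (⟨node (ℓ.root j) c.1, c.2⟩ : ℓ.Trees j.succ V))
    ⟨fun c c' h => Subtype.ext (by simpa using congrArg Subtype.val h), by
      rintro ⟨t, h1, h2, h3⟩
      obtain ⟨c, rfl⟩ := h3.exists_node
      exact ⟨⟨c, h1, h2, h3⟩, rfl⟩⟩).symm

theorem node_treesSuccEquiv (j : Fin N) (V : Finset ℕ) (t : ℓ.Trees j.succ V) :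
    node (ℓ.root j) (ℓ.treesSuccEquiv j V t).1 = t.1 :=
  congrArg Subtype.val ((ℓ.treesSuccEquiv j V).symm_apply_apply t)

theorem Branches.index_eq_iff {ℓ : ClassList 𝒞 N} {j : Fin N} {V : Finset ℕ} (c : ℓ.Branches j V)
    {s : Fin (ar (ℓ.root j)) → Fin (N + 1)} :
    (fun l => ℓ.index (c.1 l)) = s ↔ ∀ l, ℓ.Has (s l) (c.1 l) := by
  have hg : (node (ℓ.root j) c.1).Good := ⟨c.2.2.1, by rw [c.2.1]; exact V.nodup⟩
  rw [funext_iff]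
  exact forall_congr' fun l => (ℓ.has_iff_index (hg.child l) (𝒞.normal_child c.2.2.2.1 l)).symm

/-- The branches of given classes form a forest. -/
def branchesFiberEquiv (j : Fin N) (V : Finset ℕ) {s : Fin (ar (ℓ.root j)) → Fin (N + 1)}
    (hs : ℓ.coeff j s = 1) :
    {c : ℓ.Branches j V // (fun l => ℓ.index (c.1 l)) = s} ≃ ℓ.Forests s V where
  toFun c := ⟨c.1.1, c.1.2.1, fun l => ⟨c.1.2.2.1.1 l, c.1.index_eq_iff.1 c.2 l⟩, c.1.2.2.1.2⟩
  invFun c :=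
    let c' : ℓ.Branches j V := ⟨c.1, c.2.1, ⟨fun l => (c.2.2.1 l).1, c.2.2.2⟩,
      (ℓ.has_node_iff fun l => (c.2.2.1 l).2).2 hs⟩
    ⟨c', c'.index_eq_iff.2 fun l => (c.2.2.1 l).2⟩
  left_inv _ := rfl
  right_inv _ := rfl

include har hfin

/-- The tuples of branches are sorted by the tuple `s` of their classes. A fibre consists of all
forests of type `s` if the coefficient is `1`, and is empty if it is `0`. -/
theorem hasSeries_branches (j : Fin N) (V : Finset ℕ) :
    HasSeries (fun c : ℓ.Branches j V => ∑ l, (c.1 l).degree deg)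
      (∑ s, ℓ.coeff j s • (((#V).factorial : ℚ) • PowerSeries.coeff #V
        (shuffleProdList (List.ofFn fun l => ℓ.series deg (s l))))) := by
  refine HasSeries.sum_fiber (fun c l => ℓ.index (c.1 l)) univ (fun c => mem_univ _)
    fun s _ => ?_
  rcases ℓ.coeff_eq_zero_or_one j s with hs | hs
  · have : IsEmpty {c : ℓ.Branches j V // (fun l => ℓ.index (c.1 l)) = s} := ⟨fun c => by
      have := (ℓ.has_node_iff (c.1.index_eq_iff.1 c.2)).1 c.1.2.2.2
      omega⟩
    rw [hs, zero_smul]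
    exact HasSeries.of_isEmpty _
  · rw [hs, one_smul]
    exact (ℓ.hasSeries_forests har hfin s V).of_equiv (ℓ.branchesFiberEquiv j V hs) fun c => rfl

/-- Removing the root counts the same trees in two ways, with the degree shifted by that of the root
generator. -/
theorem series_succ (j : Fin N) :
    ℓ.series deg j.succ = PowerSeries.C (PowerSeries.X ^ deg (ℓ.root j)) *
      ∑ s, ℓ.coeff j s • shuffleProdList (List.ofFn fun l => ℓ.series deg (s l)) := by
  ext1 n
  have h1 := ℓ.hasSeries_trees_range hfin j.succ n
  have h2 := ((ℓ.hasSeries_branches har hfin j (range n)).add_const (deg (ℓ.root j))).of_equiv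
    (ℓ.treesSuccEquiv j (range n)) (d' := fun t => t.1.degree deg) fun t => by
      rw [← ℓ.node_treesSuccEquiv]
      rfl
  have h3 := h1.unique h2
  simp_rw [card_range, smul_comm _ (n.factorial : ℚ), ← smul_sum, mul_smul_comm] at h3
  have h4 := smul_right_injective _ (show (n.factorial : ℚ) ≠ 0 by positivity) h3
  rw [h4, PowerSeries.coeff_C_mul, map_sum]
  simp_rw [map_nsmul]

omit har in
theorem series_zero (hn : 𝒞.Normal (leaf 0)) : ℓ.series deg 0 = PowerSeries.X := by
  ext1 n
  have h1 := ℓ.hasSeries_trees_range hfin 0 n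
  have h2 : HasSeries (fun t : ℓ.Trees 0 (range n) => t.1.degree deg)
      ((n.factorial : ℚ) • PowerSeries.coeff n PowerSeries.X) := by
    rw [PowerSeries.coeff_X]
    split_ifs with h
    · subst h
      have : Unique (ℓ.Trees 0 (range 1)) :=
        { default := ⟨leaf 0, by simp [labels], trivial, hn, by rw [ℓ.rep_zero]⟩
          uniq := fun t => Subtype.ext (by
            obtain ⟨i, hi⟩ := t.2.2.2.exists_leaf
            have := t.2.1
            rw [hi] at this ⊢
            simpa [labels] using this) }
      simpa using HasSeries.of_unique (d := fun t : ℓ.Trees 0 (range 1) => t.1.degree deg) (by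
        obtain ⟨i, hi⟩ := (default : ℓ.Trees 0 (range 1)).2.2.2.exists_leaf
        rw [hi]
        rfl)
    · have : IsEmpty (ℓ.Trees 0 (range n)) := ⟨fun t => h (by
        obtain ⟨i, hi⟩ := t.2.2.2.exists_leaf
        have := t.2.1
        rw [hi] at this
        simpa [labels, eq_comm] using congrArg Multiset.card this)⟩
      rw [smul_zero]
      exact HasSeries.of_isEmpty _
  exact smul_right_injective _ (show (n.factorial : ℚ) ≠ 0 by positivity) (h1.unique h2)

theorem solvesIntegralSystem (hn : 𝒞.Normal (leaf 0)) :
    SolvesIntegralSystem ar PowerSeries.X deg ℓ.root ℓ.coeff (ℓ.series deg) :=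
  ⟨ℓ.series_zero hfin hn, ℓ.constantCoeff_series har, ℓ.series_succ har hfin⟩

end Series

/-- All normal trees are counted by the sum of the series of the classes. -/
theorem hasSeries_normal {deg : Υ → ℕ}
    (hfin : ∀ j n e, Finite {t : ℓ.Trees j (range n) // t.1.degree deg = e}) (n : ℕ) :
    HasSeries (fun t : {t : PTree ar // t.IsMon n ∧ 𝒞.Normal t} => t.1.degree deg)
      ((n.factorial : ℚ) • PowerSeries.coeff n (∑ j, ℓ.series deg j)) := by
  rw [map_sum, smul_sum]
  refine HasSeries.sum_fiber (fun t => ℓ.index t.1) univ (fun t => mem_univ _) fun j _ => ?_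
  let f : {t : {t : PTree ar // t.IsMon n ∧ 𝒞.Normal t} // ℓ.index t.1 = j} ≃
      ℓ.Trees j (range n) :=
    { toFun := fun t => ⟨t.1.1, t.1.2.1.1, t.1.2.1.2,
        (ℓ.has_iff_index t.1.2.1.good t.1.2.2).2 t.2⟩
      invFun := fun t =>
        have h : t.1.IsMon n := ⟨t.2.1, t.2.2.1⟩
        ⟨⟨t.1, h, t.2.2.2.1⟩, (ℓ.has_iff_index h.good t.2.2.2.1).1 t.2.2.2⟩
      left_inv := fun _ => rfl
      right_inv := fun _ => rfl }
  exact (ℓ.hasSeries_trees_range hfin j n).of_equiv f fun _ => rfl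

end ClassList

end

noncomputable section

open Finset PTree

/-! ### Monomial bases of quotients -/

section

variable {k : Type*} [Field k] {Υ : Type*} {ar : Υ → ℕ}

theorem exists_mem_leadingMonomials (O : AdmissibleOrder ar) {n : ℕ} {f : PTree ar →₀ k}
    (hf : f ∈ freeComponent k ar n) (h0 : f ≠ 0) :
    ∃ v ∈ f.support, ∀ w ∈ f.support, w ≠ v → O.lt w v := by
  have hmon : ∀ v ∈ f.support, v.IsMon n := fun v hv => hf hv
  have key : ∀ s : Finset (PTree ar), s.Nonempty → (∀ v ∈ s, v.IsMon n) →
      ∃ v ∈ s, ∀ w ∈ s, w ≠ v → O.lt w v := by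
    classical
    intro s hs
    induction hs using Finset.Nonempty.cons_induction with
    | singleton a => exact fun _ => ⟨a, by simp, fun w hw h => absurd (by simpa using hw) h⟩
    | cons a s ha hs ih =>
      intro hm
      have hma := hm a (mem_cons_self a s)
      have hms : ∀ v ∈ s, v.IsMon n := fun v hv => hm v (mem_cons_of_mem hv)
      obtain ⟨v, hv, hmax⟩ := ih hms
      rcases O.total n v a (hms v hv) hma with h | h | h
      · refine ⟨a, mem_cons_self a s, fun w hw hwa => ?_⟩
        have hws := (mem_cons.1 hw).resolve_left hwa
        by_cases hwv : w = v
        · exact hwv ▸ h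
        · exact O.trans n w v a (hms w hws) (hms v hv) hma (hmax w hws hwv) h
      · exact absurd (h ▸ hv) ha
      · refine ⟨v, mem_cons_of_mem hv, fun w hw hwv => ?_⟩
        rcases mem_cons.1 hw with rfl | hws
        · exact h
        · exact hmax w hws hwv
  exact key _ (Finsupp.support_nonempty_iff.2 h0) hmon

/-- The monomials of given arity and degree that are not leading monomials of an ideal. -/
def normalMonomials (O : AdmissibleOrder ar) (I : ShuffleIdeal k ar) (deg : Υ → ℕ) (n e : ℕ) :
    Set (PTree ar) :=
  {t | (t.IsMon n ∧ t.degree deg = e) ∧ t ∉ leadingMonomials O I.elements}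

/-- A nontrivial relation would be a nonzero element of `I` supported on normal monomials, and its
leading monomial could not be normal. -/
theorem linearIndependent_normalMonomials (O : AdmissibleOrder ar) (I : ShuffleIdeal k ar)
    (deg : Υ → ℕ) (n e : ℕ) :
    LinearIndependent k fun t : normalMonomials O I deg n e =>
      (I.carrier n).mkQ (Finsupp.single t.1 1) := by
  have hli : LinearIndependent k fun t : normalMonomials O I deg n e =>
      (Finsupp.single t.1 1 : PTree ar →₀ k) :=
    (Finsupp.linearIndependent_single_one k (PTree ar)).comp _ Subtype.val_injective
  refine hli.map (f := (I.carrier n).mkQ) ?_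
  rw [Submodule.ker_mkQ, Submodule.disjoint_def]
  intro f hf hfI
  by_contra h0
  have hspan : f ∈ Finsupp.supported k k (normalMonomials O I deg n e) := by
    rw [Finsupp.supported_eq_span_single]
    refine Submodule.span_mono ?_ hf
    rintro _ ⟨t, rfl⟩
    exact ⟨t.1, t.2, rfl⟩
  obtain ⟨v, hv, hmax⟩ := exists_mem_leadingMonomials O (I.le_free n hfI) h0
  exact (hspan hv).2 ⟨f, ⟨n, hfI⟩, hv, hmax⟩

/-- Gröbner reduction by well-founded induction: modulo `I`, a leading monomial is a combination of
smaller monomials. -/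
theorem span_normalMonomials (O : AdmissibleOrder ar) {I : ShuffleIdeal k ar}
    {deg : Υ → ℕ} (hI : I.IsHomogeneous deg) (n e : ℕ) :
    Submodule.span k (Set.range fun t : normalMonomials O I deg n e =>
      (I.carrier n).mkQ (Finsupp.single t.1 1)) = I.gradedQuotientComponent deg n e := by
  apply le_antisymm
  · rw [Submodule.span_le]
    rintro _ ⟨t, rfl⟩
    exact Submodule.mem_map_of_mem (single_mem_supported_iff.2 t.2.1)
  · classical
    set V := Submodule.span k (Set.range fun t : normalMonomials O I deg n e =>
      (I.carrier n).mkQ (Finsupp.single t.1 1)) with hV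
    have key : ∀ t : PTree ar, t.IsMon n → t.degree deg = e →
        (I.carrier n).mkQ (Finsupp.single t 1) ∈ V := by
      intro t ht
      refine (O.wf n).induction (P := fun t => t.degree deg = e →
        (I.carrier n).mkQ (Finsupp.single t 1) ∈ V) ht fun t ht ih hte => ?_
      by_cases hL : t ∈ leadingMonomials O I.elements
      · obtain ⟨g, ⟨m, hgm⟩, htg, hmax⟩ := hL
        obtain rfl : m = n := IsMon.eq (I.le_free m hgm htg) ht
        -- The homogeneous part in degree `e` remains in `I` and still contains `t`, so the
        -- reduction preserves the degree.
        set g' := g.filter (fun t => t.degree deg = e) with hg'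
        have hg'I : g' ∈ I.carrier m := hI m g hgm e
        have htg' : t ∈ g'.support := by
          rw [hg', Finsupp.support_filter, mem_filter]
          exact ⟨htg, hte⟩
        have hc : g' t ≠ 0 := Finsupp.mem_support_iff.1 htg'
        have hrest : (I.carrier m).mkQ (g'.erase t) ∈ V := by
          have hsum : g'.erase t = (g'.erase t).sum fun w a => a • Finsupp.single w 1 := by
            simp
          rw [hsum, Finsupp.sum, map_sum]
          refine Submodule.sum_mem _ fun w hw => ?_
          rw [map_smul]
          refine Submodule.smul_mem _ _ ?_
          rw [Finsupp.support_erase, mem_erase, hg', Finsupp.support_filter, mem_filter] at hw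
          exact ih w (I.le_free m hgm hw.2.1) (hmax w hw.2.1 hw.1) hw.2.2
        have h0 : (I.carrier m).mkQ g' = 0 := by
          rw [← LinearMap.mem_ker, Submodule.ker_mkQ]
          exact hg'I
        have hdec : g' = g' t • Finsupp.single t 1 + g'.erase t := by
          rw [Finsupp.smul_single, smul_eq_mul, mul_one, Finsupp.single_add_erase]
        rw [hdec, map_add, map_smul] at h0
        have h1 : g' t • (I.carrier m).mkQ (Finsupp.single t 1) ∈ V := by
          rw [eq_neg_of_add_eq_zero_left h0]
          exact V.neg_mem hrest
        exact (V.smul_mem_iff hc).1 h1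
      · exact Submodule.subset_span ⟨⟨t, ⟨ht, hte⟩, hL⟩, rfl⟩
    rw [ShuffleIdeal.gradedQuotientComponent, freeGradedComponent,
      Finsupp.supported_eq_span_single, Submodule.map_span_le]
    rintro _ ⟨t, ht, rfl⟩
    exact key t ht.1 ht.2

theorem finite_normalMonomials (O : AdmissibleOrder ar) {I : ShuffleIdeal k ar}
    {deg : Υ → ℕ} (hI : I.IsHomogeneous deg) (n e : ℕ)
    [Module.Finite k (I.gradedQuotientComponent deg n e)] :
    Finite (normalMonomials O I deg n e) := by
  have : Module.Finite k (Submodule.span k (Set.range fun t : normalMonomials O I deg n e =>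
      (I.carrier n).mkQ (Finsupp.single t.1 1))) := by
    rw [span_normalMonomials O hI]
    infer_instance
  exact Module.Finite.finite_basis
    (Module.Basis.span (linearIndependent_normalMonomials O I deg n e))

theorem finrank_gradedQuotientComponent (O : AdmissibleOrder ar) {I : ShuffleIdeal k ar}
    {deg : Υ → ℕ} (hI : I.IsHomogeneous deg) (n e : ℕ) :
    Module.finrank k (I.gradedQuotientComponent deg n e) =
      Nat.card (normalMonomials O I deg n e) := by
  rw [← span_normalMonomials O hI]
  exact Module.finrank_eq_nat_card_basis (Module.Basis.span (linearIndependent_normalMonomials O I deg n e))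

theorem degree_zero (t : PTree ar) : t.degree 0 = 0 := by
  induction t with
  | leaf i => rfl
  | node u c ih => simp [degree, ih]

/-- The one-variable statement will be obtained from the zero grading. -/
theorem isHomogeneous_zero (I : ShuffleIdeal k ar) : I.IsHomogeneous 0 := by
  intro n f hf e
  simp only [degree_zero]
  by_cases he : 0 = e
  · rwa [Finsupp.filter_eq_self_iff _ _ |>.2 fun _ _ => he]
  · rw [Finsupp.filter_eq_zero_iff _ _ |>.2 fun _ h => absurd h he]
    exact Submodule.zero_mem _

theorem gradedQuotientComponent_zero (I : ShuffleIdeal k ar) (n : ℕ) :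
    I.gradedQuotientComponent 0 n 0 = I.quotientComponent n := by
  simp [ShuffleIdeal.gradedQuotientComponent, ShuffleIdeal.quotientComponent, freeGradedComponent,
    freeComponent, degree_zero]

theorem finite_gradedQuotientComponent_zero (I : ShuffleIdeal k ar)
    (h : ∀ n, Module.Finite k (I.quotientComponent n)) (n e : ℕ) :
    Module.Finite k (I.gradedQuotientComponent 0 n e) := by
  have := h n
  refine Submodule.finiteDimensional_of_le (S₂ := I.quotientComponent n) (Submodule.map_mono ?_)
  exact Finsupp.supported_mono fun t ht => ht.1

theorem expSeries_eq_map (I : ShuffleIdeal k ar) :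
    I.expSeries = PowerSeries.map PowerSeries.constantCoeff (I.expSeries₂ 0) := by
  ext n
  rw [PowerSeries.coeff_map, ShuffleIdeal.expSeries, ShuffleIdeal.expSeries₂, PowerSeries.coeff_mk,
    PowerSeries.coeff_mk, ← PowerSeries.coeff_zero_eq_constantCoeff_apply, PowerSeries.coeff_mk,
    gradedQuotientComponent_zero]

end

end

noncomputable section

open Finset PTree

variable {Υ : Type*} {ar : Υ → ℕ}

namespace ClassList

variable {𝒞 : SkeletonClasses ar} {N : ℕ} (ℓ : ClassList 𝒞 N)

/-! ### Chains of unary generators -/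

/-- At zero unknowns an entry survives only if its products are empty, which forces arity one, and
the power of `t = 0` survives only in degree zero. The entry then says that this generator turns
class `i` into class `j`. -/
theorem unary_of_diffMatrix_ne_zero {deg : Υ → ℕ} {j i : Fin N}
    (h : diffMatrix ℓ.coeff (systemCoeff ℚ ar 0 deg ℓ.root) 0 0 j i ≠ 0) :
    deg (ℓ.root j) = 0 ∧ ar (ℓ.root j) = 1 ∧ ∃ s, ℓ.coeff j s = 1 ∧ ∀ l, s l = i.succ := by
  rw [diffMatrix] at h
  obtain ⟨h1, h2⟩ := mul_ne_zero_iff.1 h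
  obtain ⟨s, -, hs⟩ := exists_ne_zero_of_sum_ne_zero h2
  have hs1 : ℓ.coeff j s ≠ 0 := fun h0 => hs (by rw [h0, zero_smul])
  have hs2 : (∑ l, if s l = i.succ then
    (∏ l' with l' < l, (0 : Fin (N + 1) → ℚ) (s l')) *
      ∏ l' with l < l', (0 : Fin (N + 1) → ℚ) (s l') else 0) ≠ 0 := fun h0 => hs (by
        rw [h0, smul_zero])
  obtain ⟨l, -, hl⟩ := exists_ne_zero_of_sum_ne_zero hs2
  have hsl : s l = i.succ := by
    by_contra hne
    exact hl (if_neg hne)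
  rw [if_pos hsl] at hl
  obtain ⟨hl1, hl2⟩ := mul_ne_zero_iff.1 hl
  have hall : ∀ l', l' = l := by
    intro l'
    rcases lt_trichotomy l' l with hlt | heq | hlt
    · exact absurd (prod_eq_zero (mem_filter.2 ⟨mem_univ l', hlt⟩) rfl) hl1
    · exact heq
    · exact absurd (prod_eq_zero (mem_filter.2 ⟨mem_univ l', hlt⟩) rfl) hl2
  refine ⟨?_, ?_, s, (ℓ.coeff_eq_zero_or_one j s).resolve_left hs1, fun l' => hall l' ▸ hsl⟩
  · by_contra h0
    exact h1 (by rw [systemCoeff, zero_pow h0, zero_mul])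
  · have : Unique (Fin (ar (ℓ.root j))) := ⟨⟨l⟩, hall⟩
    exact (Fintype.card_fin _).symm.trans Fintype.card_unique

/-- A nonzero entry of a power of the matrix of unary generators of degree zero yields trees of the
same arity and degree and of large height. -/
theorem exists_high_tree {deg : Υ → ℕ} (r : ℕ) {j i : Fin N}
    (h : (diffMatrix ℓ.coeff (systemCoeff ℚ ar 0 deg ℓ.root) 0 0 ^ r) j i ≠ 0) :
    ∃ t : ℓ.Trees j.succ (ℓ.rep i.succ).labels.toFinset,
      t.1.degree deg = (ℓ.rep i.succ).degree deg ∧ r ≤ t.1.height := by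
  induction r generalizing j with
  | zero =>
    obtain rfl : j = i := by
      by_contra hne
      exact h (by rw [pow_zero, Matrix.one_apply_ne hne])
    have hg := ℓ.good j.succ
    exact ⟨⟨ℓ.rep j.succ, by rw [Multiset.toFinset_val, hg.2.dedup], hg.1, ℓ.normal j, rfl⟩, rfl,
      Nat.zero_le _⟩
  | succ r ih =>
    rw [pow_succ', Matrix.mul_apply] at h
    obtain ⟨m, -, hm⟩ := exists_ne_zero_of_sum_ne_zero h
    obtain ⟨h1, h2⟩ := mul_ne_zero_iff.1 hm
    obtain ⟨t, ht, hr⟩ := ih h2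
    obtain ⟨h3, h4, s, hs, hs'⟩ := ℓ.unary_of_diffMatrix_ne_zero h1
    have hsub : Subsingleton (Fin (ar (ℓ.root j))) := by
      rw [h4]
      infer_instance
    refine ⟨⟨node (ℓ.root j) fun _ => t.1, ?_, ⟨fun _ => t.2.2.1, Subsingleton.strictMono _⟩,
      (ℓ.has_node_iff fun l => ?_).2 hs⟩, ?_, ?_⟩
    · simp only [labels, sum_const, card_univ, Fintype.card_fin]
      rw [h4, one_smul]
      exact t.2.1
    · rw [hs']
      exact t.2.2.2
    · simp only [degree, sum_const, card_univ, Fintype.card_fin]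
      rw [h3, h4, one_smul, zero_add]
      exact ht
    · simp only [height]
      exact Nat.succ_le_succ (hr.trans (le_sup (f := fun _ : Fin (ar (ℓ.root j)) => t.1.height)
        (mem_univ ⟨0, by omega⟩)))

/-- Only finitely many trees share given labels, class and degree, so their heights are bounded. By
`exists_high_tree` a power of the matrix beyond the bound vanishes, and `1` minus a nilpotent matrix
is invertible. -/
theorem isUnit_det_rat (har : ∀ u, 0 < ar u) {deg : Υ → ℕ}
    (hfin : ∀ j n e, Finite {t : ℓ.Trees j (range n) // t.1.degree deg = e}) :
    IsUnit (1 - diffMatrix ℓ.coeff (systemCoeff ℚ ar 0 deg ℓ.root) 0 0).det := by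
  rw [← Matrix.isUnit_iff_isUnit_det]
  refine IsNilpotent.isUnit_one_sub ?_
  have hb : (⋃ (j : Fin N) (i : Fin N), Set.range
      fun t : {t : ℓ.Trees j.succ (ℓ.rep i.succ).labels.toFinset //
        t.1.degree deg = (ℓ.rep i.succ).degree deg} => t.1.1.height).Finite := by
    refine Set.finite_iUnion fun j => Set.finite_iUnion fun i => ?_
    have := (ℓ.hasSeries_trees har hfin j.succ (ℓ.rep i.succ).labels.toFinset
      ((ℓ.rep i.succ).degree deg)).1
    exact Set.finite_range _
  obtain ⟨H, hH⟩ := hb.bddAbove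
  refine ⟨H + 1, ?_⟩
  ext j i
  by_contra h
  obtain ⟨t, ht, hr⟩ := ℓ.exists_high_tree (H + 1) h
  have := hH (Set.mem_iUnion.2 ⟨j, Set.mem_iUnion.2 ⟨i, ⟨t, ht⟩, rfl⟩⟩)
  dsimp only at this
  omega

/-- Invertibility over power series in `t` is decided at `t = 0`. -/
theorem isUnit_det_powerSeries (har : ∀ u, 0 < ar u) {deg : Υ → ℕ}
    (hfin : ∀ j n e, Finite {t : ℓ.Trees j (range n) // t.1.degree deg = e}) :
    IsUnit (1 - diffMatrix ℓ.coeff (systemCoeff (PowerSeries ℚ) ar PowerSeries.X deg ℓ.root)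
      0 0).det := by
  rw [PowerSeries.isUnit_iff_constantCoeff, map_det_one_sub_diffMatrix]
  simp only [map_systemCoeff, PowerSeries.constantCoeff_X, Pi.zero_apply, map_zero]
  exact ℓ.isUnit_det_rat har hfin

/-! ### The series of all normal trees -/

open Classical in
/-- The coefficients in the sum of the series of all classes. -/
def mult (𝒞 : SkeletonClasses ar) {N : ℕ} (_ : Fin (N + 1)) : ℕ := if 𝒞.Normal (leaf 0) then 1 else 0

theorem exists_solution (har : ∀ u, 0 < ar u) {deg : Υ → ℕ}
    {E : PowerSeries (PowerSeries ℚ)}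
    (hfin : ∀ j n e, Finite {t : ℓ.Trees j (range n) // t.1.degree deg = e})
    (hE : ∀ n, HasSeries (fun t : {t : PTree ar // t.IsMon n ∧ 𝒞.Normal t} => t.1.degree deg)
      ((n.factorial : ℚ) • PowerSeries.coeff n E)) :
    ∃ y, SolvesAlgebraicSystem ar PowerSeries.X deg ℓ.root ℓ.coeff y ∧
      (∀ j n e, 0 ≤ PowerSeries.coeff e (PowerSeries.coeff n (y j))) ∧
      E = ∑ j, mult 𝒞 j • y j := by
  by_cases hn : 𝒞.Normal (leaf 0)
  · refine ⟨ℓ.series deg, (solvesIntegralSystem_iff ℓ.coeff_symm).1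
      (ℓ.solvesIntegralSystem har hfin hn), fun j n e => ?_, ?_⟩
    · rw [series, PowerSeries.coeff_mk, PowerSeries.coeff_smul, PowerSeries.coeff_mk]
      positivity
    · simp only [mult, if_pos hn, one_smul]
      ext1 n
      exact smul_right_injective _ (show (n.factorial : ℚ) ≠ 0 by positivity)
        ((hE n).unique (ℓ.hasSeries_normal hfin n))
  -- This is the degenerate case of a zero quotient. Subtrees of normal trees are normal, so without
  -- a normal leaf there are no normal trees; the system reduces to `y₀ = z` and the multiplicity is
  -- `0`.
  · have hN : IsEmpty (Fin N) := ⟨fun j => hn (𝒞.exists_normal_leaf har (ℓ.normal j))⟩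
    refine ⟨fun _ => PowerSeries.X, ⟨rfl, fun _ => PowerSeries.constantCoeff_X, fun j => hN.elim j⟩,
      fun j n e => ?_, ?_⟩
    · rw [PowerSeries.coeff_X]
      split_ifs
      · rw [PowerSeries.coeff_one]
        split_ifs <;> norm_num
      · simp
    · simp only [mult, if_neg hn, zero_smul, sum_const_zero]
      ext1 n
      have : IsEmpty {t : PTree ar // t.IsMon n ∧ 𝒞.Normal t} :=
        ⟨fun t => hn (𝒞.exists_normal_leaf har t.2.2)⟩
      have h0 := (hE n).unique (HasSeries.of_isEmpty _)
      rw [map_zero]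
      exact (smul_eq_zero.1 h0).resolve_left (by positivity)

end ClassList

/-! ### From tree counts to the series of the quotient, and algebraic relations. -/

section

variable {k : Type*} [Field k]

theorem hasSeries_expSeries₂ {O : AdmissibleOrder ar} {I : ShuffleIdeal k ar} {deg : Υ → ℕ}
    (hI : I.IsHomogeneous deg) (hfin : ∀ n e, Module.Finite k (I.gradedQuotientComponent deg n e))
    {p : PTree ar → Prop}
    (hp : ∀ n t, t.IsMon n → (t ∉ leadingMonomials O I.elements ↔ p t)) (n : ℕ) :
    HasSeries (fun t : {t : PTree ar // t.IsMon n ∧ p t} => t.1.degree deg)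
      ((n.factorial : ℚ) • PowerSeries.coeff n (I.expSeries₂ deg)) := by
  intro e
  let f : {t : {t : PTree ar // t.IsMon n ∧ p t} // t.1.degree deg = e} ≃
      normalMonomials O I deg n e :=
    { toFun := fun t => ⟨t.1.1, ⟨t.1.2.1, t.2⟩, (hp n _ t.1.2.1).2 t.1.2.2⟩
      invFun := fun t => ⟨⟨t.1, t.2.1.1, (hp n _ t.2.1.1).1 t.2.2⟩, t.2.1.2⟩
      left_inv := fun _ => rfl
      right_inv := fun _ => rfl }
  have := hfin n e
  have := finite_normalMonomials O hI n e
  refine ⟨Finite.of_equiv _ f.symm, ?_⟩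
  rw [Nat.card_congr f, ShuffleIdeal.expSeries₂, PowerSeries.coeff_mk, PowerSeries.coeff_smul,
    PowerSeries.coeff_mk, finrank_gradedQuotientComponent O hI, smul_eq_mul,
    mul_div_cancel₀ _ (by positivity)]

theorem isAlgebraic_sum_nsmul {A S ι : Type*} [CommRing A] [IsDomain A] [CommRing S] [Algebra A S]
    [Fintype ι] {y : ι → S} (m : ι → ℕ) (h : ∀ j, IsAlgebraic A (y j)) :
    IsAlgebraic A (∑ j, m j • y j) := by
  refine sum_induction _ (IsAlgebraic A) (fun _ _ => IsAlgebraic.add) isAlgebraic_zero fun j _ => ?_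
  rw [nsmul_eq_mul]
  exact (isAlgebraic_natCast (m j)).mul (h j)

/-- Without such a relation `a`, `b`, `c` would be algebraically independent, and `c` would be
transcendental over the algebra generated by the other two. -/
theorem exists_mvPolynomial_of_isAlgebraic {S : Type*} [CommRing S] [Algebra ℚ S] {a b c : S}
    (h : IsAlgebraic (Algebra.adjoin ℚ {a, b}) c) :
    ∃ Q : MvPolynomial (Fin 3) ℚ, Q ≠ 0 ∧ MvPolynomial.aeval ![a, b, c] Q = 0 := by
  by_contra! hQ
  have hind : AlgebraicIndependent ℚ ![a, b, c] := by
    rw [algebraicIndependent_iff]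
    intro Q hQ0
    by_contra hne
    exact hQ Q hne hQ0
  have := hind.transcendental_adjoin (s := {0, 1}) (i := 2) (by decide)
  rw [Set.image_pair] at this
  exact this h

end

end

/-! ### Assembly of the theorem. -/

noncomputable section

open Finset PTree

variable {Υ : Type*} {ar : Υ → ℕ}

section

variable {k : Type*} [Field k]

theorem finite_trees_of_normal {𝒞 : SkeletonClasses ar} {N : ℕ} (ℓ : ClassList 𝒞 N)
    {deg : Υ → ℕ} {E : PowerSeries (PowerSeries ℚ)}
    (hE : ∀ n, HasSeries (fun t : {t : PTree ar // t.IsMon n ∧ 𝒞.Normal t} => t.1.degree deg)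
      ((n.factorial : ℚ) • PowerSeries.coeff n E)) (j : Fin (N + 1)) (n e : ℕ) :
    Finite {t : ℓ.Trees j (range n) // t.1.degree deg = e} := by
  have := (hE n e).1
  exact Finite.of_injective (β := {t : {t : PTree ar // t.IsMon n ∧ 𝒞.Normal t} //
      t.1.degree deg = e})
    (fun t => ⟨⟨t.1.1, ⟨t.1.2.1, t.1.2.2.1⟩, t.1.2.2.2.1⟩, t.2⟩)
    fun t t' h => by
      have h' : t.1.1 = t'.1.1 := congrArg (fun x => x.1.1) h
      exact Subtype.ext (Subtype.ext h')

theorem solvesAlgebraicSystem_degree_zero_iff {R : Type*} [CommRing R] [Algebra ℚ R] {N : ℕ}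
    {root : Fin N → Υ} {q : ∀ j, (Fin (ar (root j)) → Fin (N + 1)) → ℕ} {t t' : R}
    {y : Fin (N + 1) → PowerSeries R} (h : SolvesAlgebraicSystem ar t 0 root q y) :
    SolvesAlgebraicSystem ar t' 0 root q y := by
  simpa only [SolvesAlgebraicSystem, Pi.zero_apply, pow_zero] using h

instance faithfulSMul_polynomial_powerSeries : FaithfulSMul (Polynomial ℚ) (PowerSeries ℚ) := by
  rw [faithfulSMul_iff_algebraMap_injective]
  intro p q h
  simpa [PowerSeries.algebraMap_apply'] using h

end

end

open Finset PTree in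
theorem mainTheorem7 {k : Type*} [Field k] {Υ : Type*} [Finite Υ] (ar : Υ → ℕ)
    (har : ∀ u, 0 < ar u) (O : AdmissibleOrder ar) (I : ShuffleIdeal k ar)
    (G : Set (PTree ar →₀ k)) (hfin : G.Finite) (hG : IsGroebnerBasis O I G)
    (hreg : SymmetricRegular (leadingMonomials O G) ∨
      SymmetricRegular (leadingMonomials O I.elements)) :
    (∃ (M N : ℕ) (root : Fin N → Υ) (π : Fin M → Fin N)
      (p : ∀ i, (Fin (ar (root (π i))) → Fin (M + 1)) → ℕ)
      (q : ∀ j, (Fin (ar (root j)) → Fin (N + 1)) → ℕ) (m : Fin (N + 1) → ℕ),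
      Function.Surjective π ∧ (∀ i s, p i s = 0 ∨ p i s = 1) ∧ (∀ j s, q j s = 0 ∨ q j s = 1) ∧
      CoefficientsReduce ar root π p q ∧
      ((∀ n, Module.Finite k (I.quotientComponent n)) →
        ∃ (x : Fin (M + 1) → PowerSeries ℚ) (y : Fin (N + 1) → PowerSeries ℚ),
          SolutionsReduce ar 1 0 root π p q x y ∧
          (∀ j n, 0 ≤ PowerSeries.coeff n (y j)) ∧
          I.expSeries = ∑ j, m j • y j) ∧
      (∀ deg : Υ → ℕ, I.IsHomogeneous deg →
        (∀ n e, Module.Finite k (I.gradedQuotientComponent deg n e)) →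
        ∃ (x : Fin (M + 1) → PowerSeries (PowerSeries ℚ))
          (y : Fin (N + 1) → PowerSeries (PowerSeries ℚ)),
          SolutionsReduce ar PowerSeries.X deg root π p q x y ∧
          (∀ j n e, 0 ≤ PowerSeries.coeff e (PowerSeries.coeff n (y j))) ∧
          I.expSeries₂ deg = ∑ j, m j • y j)) ∧
    ((∀ n, Module.Finite k (I.quotientComponent n)) →
      IsAlgebraic (Polynomial ℚ) I.expSeries) ∧
    (∀ deg : Υ → ℕ, I.IsHomogeneous deg →
      (∀ n e, Module.Finite k (I.gradedQuotientComponent deg n e)) →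
      ∃ Q : MvPolynomial (Fin 3) ℚ, Q ≠ 0 ∧
        MvPolynomial.aeval
          ![PowerSeries.X, PowerSeries.C PowerSeries.X, I.expSeries₂ deg] Q = 0) := by
  obtain ⟨S, D, hD, hS⟩ := exists_contains_iff har hfin hG hreg
  set 𝒞 := avoiding S D hD with h𝒞
  -- The classes, hence all coefficients of the systems, are fixed before any grading is considered.
  obtain ⟨N, ⟨ℓ⟩⟩ := exists_classList 𝒞
  have hE : ∀ deg : Υ → ℕ, I.IsHomogeneous deg →
      (∀ n e, Module.Finite k (I.gradedQuotientComponent deg n e)) → ∀ n,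
      HasSeries (fun t : {t : PTree ar // t.IsMon n ∧ 𝒞.Normal t} => t.1.degree deg)
        ((n.factorial : ℚ) • PowerSeries.coeff n (I.expSeries₂ deg)) := fun deg hI hfin =>
    hasSeries_expSeries₂ hI hfin fun n t ht => not_congr (hS n t ht)
  have hgraded : ∀ deg : Υ → ℕ, I.IsHomogeneous deg →
      (∀ n e, Module.Finite k (I.gradedQuotientComponent deg n e)) →
      (∀ j n e, Finite {t : ℓ.Trees j (range n) // t.1.degree deg = e}) ∧
      ∃ y, SolvesAlgebraicSystem ar PowerSeries.X deg ℓ.root ℓ.coeff y ∧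
        (∀ j n e, 0 ≤ PowerSeries.coeff e (PowerSeries.coeff n (y j))) ∧
        I.expSeries₂ deg = ∑ j, ClassList.mult 𝒞 j • y j := fun deg hI hfin =>
    have h := finite_trees_of_normal ℓ (hE deg hI hfin)
    ⟨h, ℓ.exists_solution har h (hE deg hI hfin)⟩
  have hungraded : (∀ n, Module.Finite k (I.quotientComponent n)) →
      IsUnit (1 - diffMatrix ℓ.coeff (systemCoeff ℚ ar 1 0 ℓ.root) 0 0).det ∧
      ∃ y : Fin (N + 1) → PowerSeries ℚ, SolvesAlgebraicSystem ar 1 0 ℓ.root ℓ.coeff y ∧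
        (∀ j n, 0 ≤ PowerSeries.coeff n (y j)) ∧
        I.expSeries = ∑ j, ClassList.mult 𝒞 j • y j := by
    intro hfin
    obtain ⟨h, y, hy, hpos, hsum⟩ := hgraded 0 (isHomogeneous_zero I)
      (finite_gradedQuotientComponent_zero I hfin)
    refine ⟨?_, fun j => PowerSeries.map PowerSeries.constantCoeff (y j),
      solvesAlgebraicSystem_degree_zero_iff (hy.map _), fun j n => ?_, ?_⟩
    -- For the zero grading `t` enters only through `t ^ 0 = 1`, also at `t = 0`, so the value of
    -- `t` may be changed to `1`.
    · have h1 := ℓ.isUnit_det_rat har h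
      have h2 : systemCoeff ℚ ar 0 0 ℓ.root = systemCoeff ℚ ar 1 0 ℓ.root := by
        funext j
        simp [systemCoeff]
      rwa [h2] at h1
    · rw [PowerSeries.coeff_map, ← PowerSeries.coeff_zero_eq_constantCoeff_apply]
      exact hpos j n 0
    · rw [expSeries_eq_map, hsum]
      simp only [map_sum, map_nsmul]
  -- The integral system already has symmetric coefficients, so no unknowns need to be merged: `M =
  -- N`, `π` is the identity and `x = y`.
  refine ⟨⟨N, N, ℓ.root, id, ℓ.coeff, ℓ.coeff, ClassList.mult 𝒞, Function.surjective_id,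
    ℓ.coeff_eq_zero_or_one, ℓ.coeff_eq_zero_or_one, coefficientsReduce_id ℓ.coeff_symm, ?_, ?_⟩,
    ?_, ?_⟩
  · intro hfin
    obtain ⟨hdet, y, hy, hpos, hsum⟩ := hungraded hfin
    exact ⟨y, y, solutionsReduce_id ℓ.coeff_symm hdet hy, hpos, hsum⟩
  · intro deg hI hfin
    obtain ⟨h, y, hy, hpos, hsum⟩ := hgraded deg hI hfin
    exact ⟨y, y, solutionsReduce_id ℓ.coeff_symm (ℓ.isUnit_det_powerSeries har h) hy, hpos, hsum⟩
  · intro hfin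
    obtain ⟨hdet, y, hy, hpos, hsum⟩ := hungraded hfin
    rw [hsum]
    refine isAlgebraic_sum_nsmul _ (hy.isAlgebraic hdet ⟨Polynomial.X, ?_⟩ ⟨1, ?_⟩
      fun c => ⟨Polynomial.C c, ?_⟩)
    · simp [PowerSeries.algebraMap_apply']
    · simp
    · simp [PowerSeries.algebraMap_apply']
  · intro deg hI hfin
    obtain ⟨h, y, hy, hpos, hsum⟩ := hgraded deg hI hfin
    refine exists_mvPolynomial_of_isAlgebraic ?_
    rw [hsum]
    refine isAlgebraic_sum_nsmul _ (hy.isAlgebraic (ℓ.isUnit_det_powerSeries har h)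
      ⟨⟨PowerSeries.X, Algebra.subset_adjoin (by simp)⟩, rfl⟩
      ⟨⟨PowerSeries.C PowerSeries.X, Algebra.subset_adjoin (by simp)⟩, rfl⟩
      fun c => ⟨algebraMap ℚ _ c, rfl⟩)
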